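/- Let $\mathsf k$ be a complex Hilbert space. For an interval $A\subseteq\mathbb R_+$ let $\mathcal F_A$ be the Boson Fock space over $L^2(A;\mathsf k)$, with exponential vectors $\varepsilon(f)$, so that $\langle\varepsilon(f),\varepsilon(g)\rangle=e^{\langle f,g\rangle}$. Write $\mathcal F=\mathcal F_{\mathbb R_+}$, $\mathcal F_{t)}=\mathcal F_{[0,t)}$, $\mathcal F_{[t}=\mathcal F_{[t,\infty)}$, and identify $\mathcal F$ with $\mathcal F_{t)}\otimes\mathcal F_{[t}$ through $\varepsilon(f)\leftrightarrow\varepsilon(f|_{[0,t)})\otimes\varepsilon(f|_{[t,\infty)})$. For $t\in[0,\infty)$ let $\theta_t$ be the isometric right shift on $L^2(\mathbb R_+;\mathsf k)$ and let $\Gamma_t$ be its second quantization, $\Gamma_t\varepsilon(f)=\varepsilon(\theta_tf)$; let $\Gamma_\infty$ be the orthogonal projection onto $\mathbb C\varepsilon(0)$. For $X\in B(\mathcal F)$ let $\sigma_t(X)=I_{t)}\otimes\Gamma_tX\Gamma_t^*$ for $t\in[0,\infty)$, where $\Gamma_t$ is regarded as a unitary from $\mathcal F$ onto $\mathcal F_{[t}$,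 and let $\sigma_\infty(X)=I$. A quantum stop time is a map $S$ from the Borel sets of $[0,\infty]$ to $B(\mathcal F)$ such that every $S(A)$ is an orthogonal projection, $A\mapsto\langle x,S(A)y\rangle$ is a complex measure for all $x,y\in\mathcal F$, $S([0,\infty])=I$, $S(\{0\})\in\mathbb CI$, and $S([0,t])\in B(\mathcal F_{t)})\otimes I_{[t}$ for all $t\in(0,\infty)$. Let $S$ be a quantum stop time with $S(\{0\})=0$ that is finite, i.e. $S(\{\infty\})=0$. For a finite partition $\pi=\{0=\pi_0<\dots<\pi_{n+1}=\infty\}$ of $[0,\infty]$ put $$\sigma_{S,\pi}(X)=\sum_{j=1}^{n+1}\sigma_{\pi_j}(X)\,S((\pi_{j-1},\pi_j]),\qquad \Gamma_{S,\pi}=\sum_{j=1}^{n+1}S((\pi_{j-1},\pi_j])\,\Gamma_{\pi_j}.$$ All limits below are along the set of finite partitions directed by refinement. Then: 1. For every $\pi$, the map $\sigma_{S,\pi}:B(\mathcal F)\to B(\mathcal F)$ is unital, multiplicative and $*$-preserving, and $X\mapsto\sigma_{S,\pi}(X)-S((\pi_n,\infty])$ is a (linear, not necessarily unital) $*$-homomorphism.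 (Since $\sigma_\infty$ is constant, $\sigma_{S,\pi}$ itself is linear only if $S((\pi_n,\infty])=0$.) 2. For every $X\in B(\mathcal F)$ the strong limit $\sigma_S(X)=\lim_\pi\sigma_{S,\pi}(X)$ exists, and $\sigma_S:B(\mathcal F)\to B(\mathcal F)$ is a (linear) unital $*$-homomorphism. 3. The strong limit $\Gamma_S=\lim_\pi\Gamma_{S,\pi}$ exists and is an isometry, and $\sigma_S(X)\Gamma_S=\Gamma_SX$ for all $X\in B(\mathcal F)$. -/

import Mathlib

open scoped TensorProduct ENNReal NNReal Topology InnerProduct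
open MeasureTheory Filter

noncomputable section

namespace QStop

universe u

/-! ### Boson Fock space -/

section Fock

/-- A bundled complex inner product space, used only to define tensor powers by recursion. -/
structure InnerBundle : Type (u + 1) where
  carrier : Type u
  [grp : NormedAddCommGroup carrier]
  [ips : InnerProductSpace ℂ carrier]

attribute [instance] InnerBundle.grp InnerBundle.ips

variable (H : Type u) [NormedAddCommGroup H] [InnerProductSpace ℂ H]

/-- Algebraic tensor powers of `H`; the zeroth power is a one-dimensional space (in the universe
of `H`). -/
def tensorBundle : ℕ → InnerBundle.{u}
  | 0 => ⟨EuclideanSpace ℂ PUnit.{u + 1}⟩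
  | n + 1 => ⟨H ⊗[ℂ] (tensorBundle n).carrier⟩

/-- The algebraic tensor power `H ⊗ (H ⊗ ⋯)` with `n` factors. -/
abbrev TPow (n : ℕ) : Type u := (tensorBundle H n).carrier

/-- The full Fock space: the Hilbert space direct sum of the Hilbert space tensor powers of `H`. -/
abbrev FullFock : Type u := lp (fun n => UniformSpace.Completion (TPow H n)) 2

variable {H}

/-- `f ⊗ ⋯ ⊗ f` with `n` factors. -/
def tpow (f : H) : (n : ℕ) → TPow H n
  | 0 => (EuclideanSpace.single PUnit.unit (1 : ℂ) : EuclideanSpace ℂ PUnit.{u + 1})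
  | n + 1 => (f ⊗ₜ[ℂ] tpow f n : H ⊗[ℂ] TPow H n)

theorem inner_tpow (f g : H) (n : ℕ) : inner ℂ (tpow f n) (tpow g n) = inner ℂ f g ^ n := by
  induction n with
  | zero =>
    change inner ℂ (EuclideanSpace.single PUnit.unit (1 : ℂ) : EuclideanSpace ℂ PUnit.{u + 1})
      (EuclideanSpace.single PUnit.unit (1 : ℂ)) = _
    simp
  | succ n ih =>
    change inner ℂ (f ⊗ₜ[ℂ] tpow f n : H ⊗[ℂ] TPow H n) (g ⊗ₜ[ℂ] tpow g n) = _
    rw [TensorProduct.inner_tmul, ih, pow_succ']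

theorem norm_tpow (f : H) (n : ℕ) : ‖tpow f n‖ = ‖f‖ ^ n := by
  have h := inner_tpow f f n
  rw [inner_self_eq_norm_sq_to_K, inner_self_eq_norm_sq_to_K] at h
  have h2 : ‖tpow f n‖ ^ 2 = (‖f‖ ^ n) ^ 2 := by
    rw [← pow_mul, mul_comm n 2, pow_mul]
    exact_mod_cast h
  exact (pow_left_inj₀ (norm_nonneg _) (by positivity) two_ne_zero).1 h2

/-- The degree `n` component `f^{⊗ n} / √(n!)` of the exponential vector of `f`. -/
def expTerm (f : H) (n : ℕ) : UniformSpace.Completion (TPow H n) :=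
  (((Real.sqrt (n.factorial : ℝ))⁻¹ : ℝ) : ℂ) • (tpow f n : UniformSpace.Completion (TPow H n))

theorem inner_expTerm (f g : H) (n : ℕ) :
    inner ℂ (expTerm f n) (expTerm g n) = (n.factorial : ℂ)⁻¹ * inner ℂ f g ^ n := by
  unfold expTerm
  rw [inner_smul_left, inner_smul_right, UniformSpace.Completion.inner_coe, inner_tpow,
    Complex.conj_ofReal, ← mul_assoc, ← Complex.ofReal_mul, ← mul_inv,
    Real.mul_self_sqrt (by positivity)]
  push_cast
  rfl

theorem norm_expTerm_sq (f : H) (n : ℕ) :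
    ‖expTerm f n‖ ^ 2 = (n.factorial : ℝ)⁻¹ * (‖f‖ ^ 2) ^ n := by
  have h := inner_expTerm f f n
  rw [inner_self_eq_norm_sq_to_K, inner_self_eq_norm_sq_to_K] at h
  refine Complex.ofReal_injective ?_
  push_cast
  exact h

theorem memℓp_expTerm (f : H) : Memℓp (expTerm f) 2 := by
  rw [memℓp_gen_iff (by norm_num)]
  have : Summable fun n : ℕ => (n.factorial : ℝ)⁻¹ * (‖f‖ ^ 2) ^ n := by
    simpa [div_eq_inv_mul] using Real.summable_pow_div_factorial (‖f‖ ^ 2)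
  refine this.congr fun n => ?_
  rw [← norm_expTerm_sq]
  simp

/-- The exponential vector of `f` in the full Fock space. -/
def fullExp (f : H) : FullFock H := ⟨expTerm f, memℓp_expTerm f⟩

theorem inner_fullExp (f g : H) :
    inner ℂ (fullExp f) (fullExp g) = Complex.exp (inner ℂ f g) := by
  rw [lp.inner_eq_tsum, Complex.exp_eq_exp_ℂ, NormedSpace.exp_eq_tsum_div]
  refine tsum_congr fun n => ?_
  change inner ℂ (expTerm f n) (expTerm g n) = _
  rw [inner_expTerm, div_eq_inv_mul]

variable (H) in
/-- Boson (symmetric) Fock space over `H`: the closed linear span of the exponential vectors in the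
full Fock space. -/
def fockSubspace : Submodule ℂ (FullFock H) :=
  (Submodule.span ℂ (Set.range (fullExp (H := H)))).topologicalClosure

variable (H) in
/-- Boson (symmetric) Fock space over `H`, as a Hilbert space. -/
def Fock : Type u := fockSubspace H

instance : NormedAddCommGroup (Fock H) := inferInstanceAs (NormedAddCommGroup (fockSubspace H))

instance : InnerProductSpace ℂ (Fock H) := inferInstanceAs (InnerProductSpace ℂ (fockSubspace H))

variable (H) in
/-- The inclusion of the Boson Fock space in the full Fock space. -/
def fockIncl : Fock H →ₗᵢ[ℂ] FullFock H := (fockSubspace H).subtypeₗᵢ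

instance : CompleteSpace (Fock H) :=
  (Submodule.isClosed_topologicalClosure _).completeSpace_coe

/-- The exponential vector `ε(f)`. -/
def ev (f : H) : Fock H :=
  ⟨fullExp f, Submodule.le_topologicalClosure _ (Submodule.subset_span ⟨f, rfl⟩)⟩

theorem inner_ev (f g : H) : inner ℂ (ev f) (ev g) = Complex.exp (inner ℂ f g) :=
  inner_fullExp f g

theorem span_ev_dense :
    (Submodule.span ℂ (Set.range (ev (H := H)))).topologicalClosure = ⊤ := by
  rw [Submodule.eq_top_iff']
  intro x
  rw [← SetLike.mem_coe, Submodule.topologicalClosure_coe,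
    (fockIncl H).isometry.isEmbedding.closure_eq_preimage_closure_image]
  have hx : fockIncl H x ∈ closure
      (Submodule.span ℂ (Set.range (fullExp (H := H))) : Set (FullFock H)) := by
    rw [← Submodule.topologicalClosure_coe]; exact x.2
  have h : (Submodule.span ℂ (Set.range (ev (H := H)))).map (fockIncl H).toLinearMap =
      Submodule.span ℂ (Set.range (fullExp (H := H))) := by
    rw [Submodule.map_span, ← Set.range_comp]; rfl
  rw [← h] at hx
  exact hx

end Fock

/-! ### Isometries determined by Gram matrices -/

section Ext

variable {ι E G : Type*} [NormedAddCommGroup E] [InnerProductSpace ℂ E]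
  [NormedAddCommGroup G] [InnerProductSpace ℂ G]

theorem norm_linearCombination_eq (a : ι → E) (b : ι → G)
    (h : ∀ i j, inner ℂ (b i) (b j) = inner ℂ (a i) (a j)) (c : ι →₀ ℂ) :
    ‖Finsupp.linearCombination ℂ b c‖ = ‖Finsupp.linearCombination ℂ a c‖ := by
  have key : inner ℂ (Finsupp.linearCombination ℂ b c) (Finsupp.linearCombination ℂ b c) =
      inner ℂ (Finsupp.linearCombination ℂ a c) (Finsupp.linearCombination ℂ a c) := by
    simp only [Finsupp.linearCombination_apply, Finsupp.sum, sum_inner, inner_sum,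
      inner_smul_left, inner_smul_right, h]
  rw [inner_self_eq_norm_sq_to_K, inner_self_eq_norm_sq_to_K] at key
  exact (pow_left_inj₀ (norm_nonneg _) (norm_nonneg _) two_ne_zero).1 (by exact_mod_cast key)

theorem denseRange_linearCombination (a : ι → E)
    (ha : (Submodule.span ℂ (Set.range a)).topologicalClosure = ⊤) :
    DenseRange (Finsupp.linearCombination ℂ a) := by
  rw [DenseRange, dense_iff_closure_eq, ← LinearMap.coe_range, Finsupp.range_linearCombination,
    ← Submodule.topologicalClosure_coe, ha, Submodule.top_coe]

variable [CompleteSpace G]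

/-- Given a total family `a` in `E` and a family `b` in `G` with the same inner products, the
linear isometry `E → G` that maps `a i` to `b i` for all `i`. -/
def isoExt (a : ι → E) (ha : (Submodule.span ℂ (Set.range a)).topologicalClosure = ⊤)
    (b : ι → G) (h : ∀ i j, inner ℂ (b i) (b j) = inner ℂ (a i) (a j)) : E →ₗᵢ[ℂ] G where
  toLinearMap := ((Finsupp.linearCombination ℂ b).extendOfNorm
    (Finsupp.linearCombination ℂ a)).toLinearMap
  norm_map' := by
    have hd := denseRange_linearCombination a ha
    refine hd.induction ?_ (isClosed_eq (by
      simp only [ContinuousLinearMap.coe_coe]; fun_prop) continuous_norm)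
    rintro _ ⟨c, rfl⟩
    rw [ContinuousLinearMap.coe_coe, LinearMap.extendOfNorm_eq hd
      ⟨1, fun x => by rw [norm_linearCombination_eq a b h, one_mul]⟩]
    exact norm_linearCombination_eq a b h c

theorem isoExt_apply (a : ι → E) (ha : (Submodule.span ℂ (Set.range a)).topologicalClosure = ⊤)
    (b : ι → G) (h : ∀ i j, inner ℂ (b i) (b j) = inner ℂ (a i) (a j)) (i : ι) :
    isoExt a ha b h (a i) = b i := by
  have := LinearMap.extendOfNorm_eq (denseRange_linearCombination a ha)
      (f := Finsupp.linearCombination ℂ b)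
      ⟨1, fun x => by rw [norm_linearCombination_eq a b h, one_mul]⟩ (Finsupp.single i 1)
  rw [Finsupp.linearCombination_single, Finsupp.linearCombination_single, one_smul,
    one_smul] at this
  exact this

/-- If `b` is total as well, the isometry is onto. -/
def isoExtEquiv [CompleteSpace E] (a : ι → E)
    (ha : (Submodule.span ℂ (Set.range a)).topologicalClosure = ⊤)
    (b : ι → G) (hb : (Submodule.span ℂ (Set.range b)).topologicalClosure = ⊤)
    (h : ∀ i j, inner ℂ (b i) (b j) = inner ℂ (a i) (a j)) : E ≃ₗᵢ[ℂ] G :=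
  LinearIsometryEquiv.ofSurjective (isoExt a ha b h) (by
    have hc : IsClosed (Set.range (isoExt a ha b h)) :=
      (isoExt a ha b h).isometry.isClosedEmbedding.isClosed_range
    rw [← Set.range_eq_univ, ← hc.closure_eq, ← dense_iff_closure_eq]
    refine (denseRange_linearCombination b hb).mono ?_
    rintro _ ⟨c, rfl⟩
    refine ⟨Finsupp.linearCombination ℂ a c, ?_⟩
    rw [← LinearIsometry.coe_toLinearMap, Finsupp.apply_linearCombination]
    congr 2
    ext i
    exact isoExt_apply a ha b h i)

theorem isoExtEquiv_apply [CompleteSpace E] (a : ι → E)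
    (ha : (Submodule.span ℂ (Set.range a)).topologicalClosure = ⊤)
    (b : ι → G) (hb : (Submodule.span ℂ (Set.range b)).topologicalClosure = ⊤)
    (h : ∀ i j, inner ℂ (b i) (b j) = inner ℂ (a i) (a j)) (i : ι) :
    isoExtEquiv a ha b hb h (a i) = b i := isoExt_apply a ha b h i

end Ext

section SecondQuantization

variable {H K : Type*} [NormedAddCommGroup H] [InnerProductSpace ℂ H]
  [NormedAddCommGroup K] [InnerProductSpace ℂ K]

/-- Second quantization of an isometry: `ε(f) ↦ ε(V f)`. -/
def secondQuant (V : H →ₗᵢ[ℂ] K) : Fock H →ₗᵢ[ℂ] Fock K :=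
  isoExt ev span_ev_dense (fun f => ev (V f)) (fun f g => by
    rw [inner_ev, inner_ev, V.inner_map_map])

theorem secondQuant_ev (V : H →ₗᵢ[ℂ] K) (f : H) : secondQuant V (ev f) = ev (V f) :=
  isoExt_apply _ _ _ _ f

/-- Second quantization of a unitary: `ε(f) ↦ ε(U f)`. -/
def secondQuantEquiv (U : H ≃ₗᵢ[ℂ] K) : Fock H ≃ₗᵢ[ℂ] Fock K :=
  isoExtEquiv ev span_ev_dense (fun f => ev (U f))
    (by rw [show Set.range (fun f => ev (U f)) = Set.range (ev (H := K)) from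
      U.surjective.range_comp ev]; exact span_ev_dense)
    (fun f g => by rw [inner_ev, inner_ev, U.inner_map_map])

theorem secondQuantEquiv_ev (U : H ≃ₗᵢ[ℂ] K) (f : H) : secondQuantEquiv U (ev f) = ev (U f) :=
  isoExtEquiv_apply _ _ _ _ _ f

end SecondQuantization

/-! ### Hilbert space tensor products -/

section Tensor

variable (E G : Type*) [NormedAddCommGroup E] [InnerProductSpace ℂ E]
  [NormedAddCommGroup G] [InnerProductSpace ℂ G]

/-- The Hilbert space tensor product of `E` and `G`. -/
abbrev HTensor : Type _ := UniformSpace.Completion (E ⊗[ℂ] G)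

variable {E G}

/-- The elementary tensor `x ⊗ y`. -/
def htmul (x : E) (y : G) : HTensor E G := ((x ⊗ₜ[ℂ] y : E ⊗[ℂ] G) : HTensor E G)

theorem inner_htmul (x x' : E) (y y' : G) :
    inner ℂ (htmul x y) (htmul x' y') = inner ℂ x x' * inner ℂ y y' := by
  unfold htmul
  rw [UniformSpace.Completion.inner_coe, TensorProduct.inner_tmul]

variable (G) in
/-- The ampliation `A ⊗ I` on the Hilbert space tensor product. -/
def ampLeft (A : E →L[ℂ] E) : HTensor E G →L[ℂ] HTensor E G := (A.rTensor G).completion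

variable (E) in
/-- The ampliation `I ⊗ B` on the Hilbert space tensor product. -/
def ampRight (B : G →L[ℂ] G) : HTensor E G →L[ℂ] HTensor E G := (B.lTensor E).completion

end Tensor

/-! ### Fock space over `L²(ℝ₊; k)` -/

section L2

/-- Lebesgue measure on the half-line `ℝ₊ = [0, ∞)`. -/
def lam : Measure ℝ := volume.restrict (Set.Ici 0)

variable (k : Type u) [NormedAddCommGroup k] [InnerProductSpace ℂ k]

/-- `L²(ℝ₊; k)`. -/
abbrev L2 : Type u := Lp k 2 lam

/-- `L²(A; k)` for `A ⊆ ℝ₊`. -/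
abbrev L2On (A : Set ℝ) : Type u := Lp k 2 (lam.restrict A)

variable {k}

/-- Restriction `f ↦ f|_A` from `L²(ℝ₊; k)` to `L²(A; k)`. -/
def resL2 (A : Set ℝ) : L2 k →L[ℂ] L2On k A := LpToLpRestrictCLM ℝ k ℂ lam 2 A

theorem lam_ae_nonneg : ∀ᵐ s ∂lam, (0 : ℝ) ≤ s := ae_restrict_mem measurableSet_Ici

theorem lam_restrict_compl (t : ℝ≥0) :
    lam.restrict (Set.Ico 0 (t : ℝ))ᶜ = lam.restrict (Set.Ici (t : ℝ)) := by
  refine Measure.restrict_congr_set ?_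
  filter_upwards [lam_ae_nonneg] with s hs
  refine propext ⟨fun h => ?_, fun h h' => ?_⟩
  · by_contra h2
    exact h ⟨hs, not_le.1 h2⟩
  · exact absurd h (not_le.2 h'.2)

theorem inner_resL2 (f g : L2 k) (A : Set ℝ) :
    inner ℂ (resL2 A f) (resL2 A g) = ∫ s in A, inner ℂ (f s) (g s) ∂lam := by
  rw [L2.inner_def]
  refine integral_congr_ae ?_
  filter_upwards [LpToLpRestrictCLM_coeFn ℂ A f, LpToLpRestrictCLM_coeFn ℂ A g] with s h1 h2
  simp only [resL2, h1, h2]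

theorem inner_split (t : ℝ≥0) (f g : L2 k) :
    inner ℂ (resL2 (Set.Ico 0 (t : ℝ)) f) (resL2 (Set.Ico 0 (t : ℝ)) g) +
      inner ℂ (resL2 (Set.Ici (t : ℝ)) f) (resL2 (Set.Ici (t : ℝ)) g) = inner ℂ f g := by
  rw [inner_resL2, inner_resL2, ← lam_restrict_compl, L2.inner_def]
  exact integral_add_compl measurableSet_Ico (L2.integrable_inner f g)

theorem exists_glue (t : ℝ≥0) (f : L2On k (Set.Ico 0 (t : ℝ))) (g : L2On k (Set.Ici (t : ℝ))) :
    ∃ h : L2 k, resL2 (Set.Ico 0 (t : ℝ)) h = f ∧ resL2 (Set.Ici (t : ℝ)) h = g := by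
  have hf : MemLp ((Set.Ico 0 (t : ℝ)).indicator f) 2 lam :=
    (memLp_indicator_iff_restrict measurableSet_Ico).2 (Lp.memLp f)
  have hg : MemLp ((Set.Ici (t : ℝ)).indicator g) 2 lam :=
    (memLp_indicator_iff_restrict measurableSet_Ici).2 (Lp.memLp g)
  refine ⟨(hf.add hg).toLp _, ?_, ?_⟩
  · refine Lp.ext ?_
    filter_upwards [LpToLpRestrictCLM_coeFn ℂ (Set.Ico 0 (t : ℝ)) ((hf.add hg).toLp _),
      ae_restrict_of_ae (hf.add hg).coeFn_toLp, ae_restrict_mem measurableSet_Ico] with s h1 h2 h3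
    rw [resL2, h1, h2, Pi.add_apply, Set.indicator_of_mem h3,
      Set.indicator_of_notMem (by simpa using h3.2), add_zero]
  · refine Lp.ext ?_
    filter_upwards [LpToLpRestrictCLM_coeFn ℂ (Set.Ici (t : ℝ)) ((hf.add hg).toLp _),
      ae_restrict_of_ae (hf.add hg).coeFn_toLp, ae_restrict_mem measurableSet_Ici] with s h1 h2 h3
    rw [resL2, h1, h2, Pi.add_apply, Set.indicator_of_mem h3,
      Set.indicator_of_notMem (fun h => absurd h.2 (not_lt.2 h3)), zero_add]

theorem span_htmul_ev_dense (H K : Type*) [NormedAddCommGroup H] [InnerProductSpace ℂ H]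
    [NormedAddCommGroup K] [InnerProductSpace ℂ K] :
    (Submodule.span ℂ (Set.range fun p : H × K => htmul (ev p.1) (ev p.2))).topologicalClosure
      = ⊤ := by
  set M := (Submodule.span ℂ
    (Set.range fun p : H × K => htmul (ev p.1) (ev p.2))).topologicalClosure with hM
  have hMc : IsClosed (M : Set (HTensor (Fock H) (Fock K))) :=
    Submodule.isClosed_topologicalClosure _
  have c1 : ∀ y : Fock K, Continuous fun x : Fock H => htmul x y := fun y =>
    (UniformSpace.Completion.continuous_coe _).comp
      (TensorProduct.continuous_tmul.comp (by fun_prop : Continuous fun x : Fock H => (x, y)))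
  have c2 : ∀ x : Fock H, Continuous fun y : Fock K => htmul x y := fun x =>
    (UniformSpace.Completion.continuous_coe _).comp
      (TensorProduct.continuous_tmul.comp (by fun_prop : Continuous fun y : Fock K => (x, y)))
  have a1 : ∀ (x x' : Fock H) (y : Fock K), htmul (x + x') y = htmul x y + htmul x' y := by
    intro x x' y; simp [htmul, TensorProduct.add_tmul, UniformSpace.Completion.coe_add]
  have a2 : ∀ (x : Fock H) (y y' : Fock K), htmul x (y + y') = htmul x y + htmul x y' := by
    intro x x' y; simp [htmul, TensorProduct.tmul_add, UniformSpace.Completion.coe_add]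
  have m1 : ∀ (c : ℂ) (x : Fock H) (y : Fock K), htmul (c • x) y = c • htmul x y := by
    intro c x y
    exact UniformSpace.Completion.coe_smul c (x ⊗ₜ[ℂ] y : Fock H ⊗[ℂ] Fock K)
  have m2 : ∀ (c : ℂ) (x : Fock H) (y : Fock K), htmul x (c • y) = c • htmul x y := by
    intro c x y
    unfold htmul
    rw [TensorProduct.tmul_smul]
    exact UniformSpace.Completion.coe_smul c (x ⊗ₜ[ℂ] y : Fock H ⊗[ℂ] Fock K)
  have z1 : ∀ (y : Fock K), htmul (0 : Fock H) y = 0 := by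
    intro y; rw [htmul, TensorProduct.zero_tmul, UniformSpace.Completion.coe_zero]
  have z2 : ∀ (x : Fock H), htmul x (0 : Fock K) = 0 := by
    intro x; rw [htmul, TensorProduct.tmul_zero, UniformSpace.Completion.coe_zero]
  have s0 : ∀ f g, htmul (ev f) (ev g) ∈ M := fun f g =>
    Submodule.le_topologicalClosure _ (Submodule.subset_span ⟨(f, g), rfl⟩)
  have s1 : ∀ (x : Fock H) (g : K), htmul x (ev g) ∈ M := by
    intro x g
    have dense_H : x ∈ closure (Submodule.span ℂ (Set.range (ev (H := H))) : Set (Fock H)) := by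
      rw [← Submodule.topologicalClosure_coe, span_ev_dense]; trivial
    refine closure_minimal (t := (fun x : Fock H => htmul x (ev g)) ⁻¹' M) ?_
      (hMc.preimage (c1 _)) dense_H
    intro y hy
    induction hy using Submodule.span_induction with
    | mem y hy => obtain ⟨f, rfl⟩ := hy; exact s0 f g
    | zero => change htmul _ _ ∈ M; rw [z1]; exact M.zero_mem
    | add y y' _ _ h1 h2 => change htmul _ _ ∈ M; rw [a1]; exact M.add_mem h1 h2
    | smul c y _ h1 => change htmul _ _ ∈ M; rw [m1]; exact M.smul_mem c h1
  have s2 : ∀ (x : Fock H) (y : Fock K), htmul x y ∈ M := by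
    intro x y
    have dense_K : y ∈ closure (Submodule.span ℂ (Set.range (ev (H := K))) : Set (Fock K)) := by
      rw [← Submodule.topologicalClosure_coe, span_ev_dense]; trivial
    refine closure_minimal (t := (fun y : Fock K => htmul x y) ⁻¹' M) ?_
      (hMc.preimage (c2 _)) dense_K
    intro y hy
    induction hy using Submodule.span_induction with
    | mem y hy => obtain ⟨f, rfl⟩ := hy; exact s1 x f
    | zero => change htmul _ _ ∈ M; rw [z2]; exact M.zero_mem
    | add y y' _ _ h1 h2 => change htmul _ _ ∈ M; rw [a2]; exact M.add_mem h1 h2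
    | smul c y _ h1 => change htmul _ _ ∈ M; rw [m2]; exact M.smul_mem c h1
  rw [Submodule.eq_top_iff']
  intro z
  refine UniformSpace.Completion.induction_on z hMc fun w => ?_
  induction w using TensorProduct.induction_on with
  | zero => rw [UniformSpace.Completion.coe_zero]; exact M.zero_mem
  | tmul x y => exact s2 x y
  | add x y hx hy => rw [UniformSpace.Completion.coe_add]; exact M.add_mem hx hy

variable (k)

/-- The Fock space `F` over `L²(ℝ₊; k)`. -/
abbrev F : Type u := Fock (L2 k)

/-- The Fock space `F_{t)}` over `L²([0, t); k)`. -/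
abbrev FPre (t : ℝ≥0) : Type u := Fock (L2On k (Set.Ico 0 (t : ℝ)))

/-- The Fock space `F_{[t}` over `L²([t, ∞); k)`. -/
abbrev FPost (t : ℝ≥0) : Type u := Fock (L2On k (Set.Ici (t : ℝ)))

/-- The tensor product decomposition `F ≅ F_{t)} ⊗ F_{[t}`, with
`ε(f) ↦ ε(f|_{[0, t)}) ⊗ ε(f|_{[t, ∞)})`. -/
def split (t : ℝ≥0) : F k ≃ₗᵢ[ℂ] HTensor (FPre k t) (FPost k t) :=
  isoExtEquiv ev span_ev_dense
    (fun f => htmul (ev (resL2 (Set.Ico 0 (t : ℝ)) f)) (ev (resL2 (Set.Ici (t : ℝ)) f)))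
    (by
      rw [← span_htmul_ev_dense]
      congr 2
      ext z
      constructor
      · rintro ⟨f, rfl⟩
        exact ⟨(_, _), rfl⟩
      · rintro ⟨⟨f, g⟩, rfl⟩
        obtain ⟨h, h1, h2⟩ := exists_glue t f g
        exact ⟨h, by simp only [h1, h2]⟩)
    (fun f g => by
      rw [inner_htmul, inner_ev, inner_ev, inner_ev, ← Complex.exp_add, inner_split])

theorem split_ev (t : ℝ≥0) (f : L2 k) :
    split k t (ev f) =
      htmul (ev (resL2 (Set.Ico 0 (t : ℝ)) f)) (ev (resL2 (Set.Ici (t : ℝ)) f)) :=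
  isoExtEquiv_apply _ _ _ _ _ f

end L2

/-! ### Shifts and the CCR flow -/

section Shift

theorem lam_restrict_Ici (t : ℝ≥0) :
    lam.restrict (Set.Ici (t : ℝ)) = volume.restrict (Set.Ici (t : ℝ)) := by
  rw [lam, Measure.restrict_restrict measurableSet_Ici]
  congr 1
  exact Set.inter_eq_left.2 (Set.Ici_subset_Ici.2 t.2)

theorem measurePreserving_sub (t : ℝ≥0) :
    MeasurePreserving (fun s : ℝ => s - t) (lam.restrict (Set.Ici (t : ℝ))) lam := by
  have h := (measurePreserving_sub_right (volume : Measure ℝ) (t : ℝ)).restrict_preimage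
    (measurableSet_Ici (a := (0 : ℝ)))
  have e : (fun s : ℝ => s - t) ⁻¹' Set.Ici 0 = Set.Ici (t : ℝ) := by ext s; simp
  rw [e] at h
  rw [lam_restrict_Ici, lam]
  exact h

theorem measurePreserving_add (t : ℝ≥0) :
    MeasurePreserving (fun s : ℝ => s + t) lam (lam.restrict (Set.Ici (t : ℝ))) := by
  have h := (measurePreserving_add_right (volume : Measure ℝ) (t : ℝ)).restrict_preimage
    (measurableSet_Ici (a := (t : ℝ)))
  have e : (fun s : ℝ => s + t) ⁻¹' Set.Ici (t : ℝ) = Set.Ici 0 := by ext s; simp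
  rw [e] at h
  rw [lam_restrict_Ici, lam]
  exact h

variable (k : Type u) [NormedAddCommGroup k] [InnerProductSpace ℂ k]

/-- The right shift as a unitary from `L²(ℝ₊; k)` onto `L²([t, ∞); k)`: `f ↦ f(· - t)`. -/
def shiftOnto (t : ℝ≥0) : L2 k ≃ₗᵢ[ℂ] L2On k (Set.Ici (t : ℝ)) :=
  LinearIsometryEquiv.ofSurjective
    (Lp.compMeasurePreservingₗᵢ ℂ (fun s : ℝ => s - t) (measurePreserving_sub t)) (by
      intro g
      refine ⟨Lp.compMeasurePreserving (fun s : ℝ => s + t) (measurePreserving_add t) g, ?_⟩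
      refine Lp.ext ?_
      refine (Lp.coeFn_compMeasurePreserving _ (measurePreserving_sub t)).trans ?_
      have h := (measurePreserving_sub t).quasiMeasurePreserving.ae_eq_comp
        (Lp.coeFn_compMeasurePreserving g (measurePreserving_add t))
      refine h.trans (Eventually.of_forall fun s => ?_)
      simp)

variable {k} in
/-- Extension by zero from `L²([t, ∞); k)` to `L²(ℝ₊; k)`. -/
def extZero (t : ℝ≥0) (g : L2On k (Set.Ici (t : ℝ))) : L2 k :=
  ((memLp_indicator_iff_restrict measurableSet_Ici).2 (Lp.memLp g)).toLp
    ((Set.Ici (t : ℝ)).indicator g)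

set_option linter.unusedSectionVars false in
variable {k} in
theorem extZero_coeFn (t : ℝ≥0) (g : L2On k (Set.Ici (t : ℝ))) :
    extZero t g =ᵐ[lam] (Set.Ici (t : ℝ)).indicator g := MemLp.coeFn_toLp _

variable {k} in
theorem ae_of_restrict_Ici {t : ℝ≥0} {p : ℝ → Prop}
    (h : ∀ᵐ s ∂lam.restrict (Set.Ici (t : ℝ)), p s) : ∀ᵐ s ∂lam, s ∈ Set.Ici (t : ℝ) → p s :=
  (ae_restrict_iff' measurableSet_Ici).1 h

/-- The isometric right shift `θ_t` on `L²(ℝ₊; k)`: `(θ_t f)(s) = f(s - t)` if `s ≥ t`, and `0`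
otherwise. -/
def shift (t : ℝ≥0) : L2 k →ₗᵢ[ℂ] L2 k where
  toFun f := extZero t (shiftOnto k t f)
  map_add' f g := by
    rw [map_add]
    refine Lp.ext ?_
    filter_upwards [extZero_coeFn t (shiftOnto k t f + shiftOnto k t g),
      extZero_coeFn t (shiftOnto k t f), extZero_coeFn t (shiftOnto k t g),
      Lp.coeFn_add (extZero t (shiftOnto k t f)) (extZero t (shiftOnto k t g)),
      ae_of_restrict_Ici (Lp.coeFn_add (shiftOnto k t f) (shiftOnto k t g))] with s h1 h2 h3 h4 h5
    rw [h1, h4, Pi.add_apply, h2, h3]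
    by_cases hs : s ∈ Set.Ici (t : ℝ)
    · simp only [Set.indicator_of_mem hs, h5 hs, Pi.add_apply]
    · simp only [Set.indicator_of_notMem hs, add_zero]
  map_smul' c f := by
    rw [map_smul]
    refine Lp.ext ?_
    filter_upwards [extZero_coeFn t (c • shiftOnto k t f), extZero_coeFn t (shiftOnto k t f),
      Lp.coeFn_smul c (extZero t (shiftOnto k t f)),
      ae_of_restrict_Ici (Lp.coeFn_smul c (shiftOnto k t f))] with s h1 h2 h3 h4
    rw [RingHom.id_apply, h1, h3, Pi.smul_apply, h2]
    by_cases hs : s ∈ Set.Ici (t : ℝ)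
    · simp only [Set.indicator_of_mem hs, h4 hs, Pi.smul_apply]
    · simp only [Set.indicator_of_notMem hs, smul_zero]
  norm_map' f := by
    change ‖extZero t (shiftOnto k t f)‖ = ‖f‖
    rw [← (shiftOnto k t).norm_map f, extZero, Lp.norm_toLp,
      eLpNorm_indicator_eq_eLpNorm_restrict measurableSet_Ici, Lp.norm_def]

theorem shift_coeFn (t : ℝ≥0) (f : L2 k) :
    shift k t f =ᵐ[lam] fun s => if (t : ℝ) ≤ s then f (s - t) else 0 := by
  filter_upwards [extZero_coeFn t (shiftOnto k t f),
    ae_of_restrict_Ici (Lp.coeFn_compMeasurePreserving f (measurePreserving_sub t))] with s h1 h2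
  change extZero t (shiftOnto k t f) s = _
  rw [h1]
  by_cases hs : (t : ℝ) ≤ s
  · rw [Set.indicator_of_mem (Set.mem_Ici.2 hs), if_pos hs]
    exact h2 hs
  · rw [Set.indicator_of_notMem (by simpa using hs), if_neg hs]

/-- `E_0`: the orthogonal projection of `F` onto the vacuum line `ℂ ε(0)`. -/
def vacProj : F k →L[ℂ] F k := (ℂ ∙ (ev (0 : L2 k))).starProjection

/-- The second-quantized right shift `Γ_t : F → F`, `ε(f) ↦ ε(θ_t f)`, for `t ∈ [0, ∞)`, together
with `Γ_∞ = E_0`. -/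
def Gam (t : ℝ≥0∞) : F k →L[ℂ] F k :=
  if t = ∞ then vacProj k else (secondQuant (shift k t.toNNReal)).toContinuousLinearMap

/-- `Γ_t` regarded as a unitary from `F` onto `F_{[t}`. -/
def GamOnto (t : ℝ≥0) : F k ≃ₗᵢ[ℂ] FPost k t := secondQuantEquiv (shiftOnto k t)

variable {k}

/-- `A ⊗ I_{[t}` as an operator on `F ≅ F_{t)} ⊗ F_{[t}`. -/
def preOp (t : ℝ≥0) (A : FPre k t →L[ℂ] FPre k t) : F k →L[ℂ] F k :=
  ((split k t).symm : HTensor (FPre k t) (FPost k t) →L[ℂ] F k) ∘L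
    ampLeft (FPost k t) A ∘L (split k t : F k →L[ℂ] HTensor (FPre k t) (FPost k t))

/-- `I_{t)} ⊗ B` as an operator on `F ≅ F_{t)} ⊗ F_{[t}`. -/
def postOp (t : ℝ≥0) (B : FPost k t →L[ℂ] FPost k t) : F k →L[ℂ] F k :=
  ((split k t).symm : HTensor (FPre k t) (FPost k t) →L[ℂ] F k) ∘L
    ampRight (FPre k t) B ∘L (split k t : F k →L[ℂ] HTensor (FPre k t) (FPost k t))

/-- The CCR flow: `σ_t(X) = I_{t)} ⊗ Γ_t X Γ_t^*` for `t ∈ [0, ∞)`. -/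
def ccrFlow (t : ℝ≥0) (X : F k →L[ℂ] F k) : F k →L[ℂ] F k :=
  postOp t ((GamOnto k t : F k →L[ℂ] FPost k t) ∘L X ∘L
    ((GamOnto k t).symm : FPost k t →L[ℂ] F k))

/-- The CCR flow extended to `t ∈ [0, ∞]` by `σ_∞(X) = I`. -/
def ccr (t : ℝ≥0∞) (X : F k →L[ℂ] F k) : F k →L[ℂ] F k :=
  if t = ∞ then 1 else ccrFlow t.toNNReal X

end Shift

/-! ### Quantum stop times -/

section StopTime

variable (k : Type u) [NormedAddCommGroup k] [InnerProductSpace ℂ k] [CompleteSpace k]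

/-- A quantum stop time: an identity-adapted spectral measure on the Borel sets of `[0, ∞]`.
(The values of `toFun` at sets that are not Borel play no role.) -/
structure QuantumStopTime where
  /-- `A ↦ S(A)` -/
  toFun : Set ℝ≥0∞ → F k →L[ℂ] F k
  isProj : ∀ A, MeasurableSet A → IsStarProjection (toFun A)
  isMeasure : ∀ x y : F k, ∃ μ : ComplexMeasure ℝ≥0∞,
    ∀ A, MeasurableSet A → μ A = inner ℂ x (toFun A y)
  map_univ : toFun Set.univ = 1
  adapted_zero : ∃ c : ℂ, toFun {0} = c • (1 : F k →L[ℂ] F k)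
  adapted : ∀ t : ℝ≥0, 0 < t → ∃ A : FPre k t →L[ℂ] FPre k t,
    toFun (Set.Icc 0 (t : ℝ≥0∞)) = preOp t A

/-- A finite quantum stop time: `S({0}) = 0` (the trivial case of stopping immediately at time `0`
is excluded throughout) and `S({∞}) = 0`. -/
structure QuantumStopTime.IsFinite {k : Type u} [NormedAddCommGroup k] [InnerProductSpace ℂ k]
    [CompleteSpace k] (S : QuantumStopTime k) : Prop where
  zero : S.toFun {0} = 0
  top : S.toFun {∞} = 0

end StopTime

/-! ### Finite partitions of `[0, ∞]` and Riemann sums -/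

section Riemann

/-- A finite partition `0 = π_0 < ⋯ < π_{n+1} = ∞` of `[0, ∞]`. -/
structure TimePartition where
  n : ℕ
  pt : Fin (n + 2) → ℝ≥0∞
  strictMono : StrictMono pt
  pt_zero : pt 0 = 0
  pt_last : pt (Fin.last (n + 1)) = ∞

/-- Partitions are ordered by refinement: `π ≤ π'` if every point of `π` is a point of `π'`. -/
instance : Preorder TimePartition where
  le p q := Set.range p.pt ⊆ Set.range q.pt
  le_refl _ := subset_rfl
  le_trans _ _ _ := Set.Subset.trans

/-- Every finite subset of `[0, ∞]` that contains `0` and `∞` is a partition. -/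
theorem TimePartition.exists_of_finset (s : Finset ℝ≥0∞) (h0 : 0 ∈ s) (h1 : ∞ ∈ s) :
    ∃ p : TimePartition, Set.range p.pt = s := by
  have hc : 1 < s.card := Finset.one_lt_card.2 ⟨0, h0, ∞, h1, by simp⟩
  obtain ⟨n, hn⟩ : ∃ n, s.card = n + 2 := ⟨s.card - 2, by omega⟩
  refine ⟨⟨n, s.orderEmbOfFin hn, (s.orderEmbOfFin hn).strictMono, ?_, ?_⟩,
    Finset.range_orderEmbOfFin s hn⟩
  · have h := Finset.orderEmbOfFin_zero hn (by omega)
    rw [show (0 : Fin (n + 2)) = ⟨0, by omega⟩ from rfl, h]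
    exact le_antisymm (Finset.min'_le _ _ h0) bot_le
  · have h := Finset.orderEmbOfFin_last hn (by omega)
    rw [show Fin.last (n + 1) = ⟨n + 2 - 1, by omega⟩ from rfl, h]
    exact le_antisymm le_top (Finset.le_max' _ _ h1)

instance : Nonempty TimePartition :=
  ⟨(TimePartition.exists_of_finset {0, ∞} (by simp) (by simp)).choose⟩

instance : IsDirectedOrder TimePartition where
  directed p q := by
    classical
    obtain ⟨r, hr⟩ := TimePartition.exists_of_finset
      (Finset.univ.image p.pt ∪ Finset.univ.image q.pt)
      (by simp only [Finset.mem_union, Finset.mem_image]; exact .inl ⟨0, by simp, p.pt_zero⟩)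
      (by simp only [Finset.mem_union, Finset.mem_image]; exact .inl ⟨_, by simp, p.pt_last⟩)
    refine ⟨r, ?_, ?_⟩
    · change Set.range p.pt ⊆ Set.range r.pt
      rw [hr]; simp
    · change Set.range q.pt ⊆ Set.range r.pt
      rw [hr]; simp

variable {k : Type u} [NormedAddCommGroup k] [InnerProductSpace ℂ k] [CompleteSpace k]

/-- `S((π_{j-1}, π_j])`, with `j ∈ {1, …, n + 1}` indexed as `j - 1 : Fin (n + 1)`. -/
def stopIncr (S : QuantumStopTime k) (p : TimePartition) (j : Fin (p.n + 1)) :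
    F k →L[ℂ] F k :=
  S.toFun (Set.Ioc (p.pt j.castSucc) (p.pt j.succ))

/-- The Riemann sum `σ_{S,π}(X) = ∑_j σ_{π_j}(X) S((π_{j-1}, π_j])`. -/
def flowSum (S : QuantumStopTime k) (p : TimePartition) (X : F k →L[ℂ] F k) : F k →L[ℂ] F k :=
  ∑ j : Fin (p.n + 1), ccr (p.pt j.succ) X * stopIncr S p j

/-- The Riemann sum `Γ_{S,π} = ∑_j S((π_{j-1}, π_j]) Γ_{π_j}`. -/
def shiftSum (S : QuantumStopTime k) (p : TimePartition) : F k →L[ℂ] F k :=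
  ∑ j : Fin (p.n + 1), stopIncr S p j * Gam k (p.pt j.succ)

end Riemann

end QStop

end

/-! Adaptedness places an increment P = S((s,t]) in B(F_{t)}) ⊗ I, while σ_t(X) lies in I ⊗
B(F_{[t}). They commute, because the integrand is taken at the right endpoint of the interval. A sum
of `*`-homomorphisms cut down by commuting, mutually orthogonal projections is again a
`*`-homomorphism. This gives the algebra of the Riemann sums; the constant σ_∞ only adds the last
increment.

Both limits are limits of sums ∑_j P_j v(π_j), with v(t) = σ_t(X)ε(f) or v(t) = Γ_t x, and both
follow from the Cauchy criterion `exists_tendsto_riemannSum`. Under refinement the difference is a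
sum of mutually orthogonal vectors P_j(v(t) - v(b)), so by Pythagoras it is enough that each is at
most η‖P_j w‖ for one fixed w. The unbounded interval is controlled by ‖S((T,∞])w‖, which tends to 0
because S({∞}) = 0.

The local bounds come from the tensor factorization. By the semigroup law σ_t(X) - σ_{t+r}(X) =
σ_t(X - σ_r(X)), and `norm_Ioc_ccrFlow_ev_le` gives ‖P σ_t(Z)ε(f)‖ ≤ ‖Zε(θ_t^* f)‖‖Pε(f)‖. Here Z =
X - σ_r(X) is small uniformly on the compact set {ε(θ_t^* f) : t ≤ T}, since σ_r(X) → X strongly.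
For the shift, ‖PΓ_t x‖ = ‖Pε(0)‖‖x‖ (`norm_Ioc_Gam`), so w = ε(0) and strong continuity of Γ
suffices.

The last increment tends strongly to 0. This restores linearity of σ_S, makes Γ_S isometric, and
removes the defect in the intertwining relation `flowSum_mul_shiftSum`. -/

namespace QStop

universe u

/-! ### Ampliations on Hilbert space tensor products -/

section Tensor

variable {E G : Type*} [NormedAddCommGroup E] [InnerProductSpace ℂ E]
  [NormedAddCommGroup G] [InnerProductSpace ℂ G]

theorem ampLeft_htmul (A : E →L[ℂ] E) (x : E) (y : G) :
    ampLeft G A (htmul x y) = htmul (A x) y := by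
  rw [ampLeft, htmul, ContinuousLinearMap.completion_apply_coe]
  rfl

theorem ampRight_htmul (B : G →L[ℂ] G) (x : E) (y : G) :
    ampRight E B (htmul x y) = htmul x (B y) := by
  rw [ampRight, htmul, ContinuousLinearMap.completion_apply_coe]
  rfl

theorem htmul_add_right (x : E) (y y' : G) : htmul x (y + y') = htmul x y + htmul x y' := by
  simp [htmul, TensorProduct.tmul_add, UniformSpace.Completion.coe_add]

theorem htmul_smul_right (c : ℂ) (x : E) (y : G) : htmul x (c • y) = c • htmul x y := by
  unfold htmul
  rw [TensorProduct.tmul_smul]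
  exact UniformSpace.Completion.coe_smul c (x ⊗ₜ[ℂ] y : E ⊗[ℂ] G)

theorem htmul_smul_left (c : ℂ) (x : E) (y : G) : htmul (c • x) y = c • htmul x y :=
  UniformSpace.Completion.coe_smul c (x ⊗ₜ[ℂ] y : E ⊗[ℂ] G)

theorem htmul_zero_right (x : E) : htmul x (0 : G) = 0 := by
  rw [htmul, TensorProduct.tmul_zero, UniformSpace.Completion.coe_zero]

theorem norm_htmul (x : E) (y : G) : ‖htmul x y‖ = ‖x‖ * ‖y‖ := by
  rw [htmul, UniformSpace.Completion.norm_coe, TensorProduct.norm_tmul]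

/-- The operator `y ↦ x ⊗ y`. -/
noncomputable def htmulRight (x : E) : G →L[ℂ] HTensor E G :=
  LinearMap.mkContinuous ⟨⟨htmul x, htmul_add_right x⟩, fun c y => htmul_smul_right c x y⟩ ‖x‖
    fun y => (norm_htmul x y).le

theorem htmulRight_apply (x : E) (y : G) : htmulRight x y = htmul x y := rfl

/-- Operators on a Hilbert space tensor product that agree on elementary tensors are equal. -/
theorem htensor_ext {M : Type*} [NormedAddCommGroup M] [NormedSpace ℂ M]
    {A B : HTensor E G →L[ℂ] M} (h : ∀ x y, A (htmul x y) = B (htmul x y)) : A = B := by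
  ext z
  refine UniformSpace.Completion.induction_on z
    (isClosed_eq A.continuous B.continuous) fun w => ?_
  induction w using TensorProduct.induction_on with
  | zero => rw [UniformSpace.Completion.coe_zero, map_zero, map_zero]
  | tmul x y => exact h x y
  | add x y hx hy => rw [UniformSpace.Completion.coe_add, map_add, map_add, hx, hy]

/-- Operators on a Hilbert space tensor product with the same matrix elements between elementary
tensors are equal. -/
theorem htensor_ext_inner {A B : HTensor E G →L[ℂ] HTensor E G}
    (h : ∀ x y x' y', inner ℂ (htmul x' y') (A (htmul x y)) =
      inner ℂ (htmul x' y') (B (htmul x y))) : A = B := by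
  refine htensor_ext fun x y => ?_
  have key : innerSL ℂ (A (htmul x y)) = innerSL ℂ (B (htmul x y)) := by
    refine htensor_ext fun x' y' => ?_
    rw [innerSL_apply_apply, innerSL_apply_apply, ← inner_conj_symm, h, inner_conj_symm]
  exact ext_inner_right ℂ fun v => by
    simpa only [innerSL_apply_apply] using congrArg (fun T => T v) key

theorem commute_ampLeft_ampRight (A : E →L[ℂ] E) (B : G →L[ℂ] G) :
    Commute (ampLeft G A) (ampRight E B) := by
  refine htensor_ext fun x y => ?_
  simp only [mul_apply_eq_comp, ampLeft_htmul, ampRight_htmul]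

variable (E) in
/-- The ampliation `B ↦ I ⊗ B` as a unital `*`-homomorphism. -/
noncomputable def ampRightHom [CompleteSpace G] :
    (G →L[ℂ] G) →⋆ₐ[ℂ] (HTensor E G →L[ℂ] HTensor E G) where
  toFun := ampRight E
  map_one' := htensor_ext fun x y => by rw [ampRight_htmul]; rfl
  map_mul' A B := htensor_ext fun x y => by
    simp only [mul_apply_eq_comp, ampRight_htmul]
  map_zero' := htensor_ext fun x y => by
    rw [ampRight_htmul, _root_.zero_apply, htmul_zero_right,
      _root_.zero_apply]
  map_add' A B := htensor_ext fun x y => by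
    simp only [_root_.add_apply, ampRight_htmul, htmul_add_right]
  commutes' c := htensor_ext fun x y => by
    simp only [Algebra.algebraMap_eq_smul_one, _root_.smul_apply,
      one_apply_eq_self, ampRight_htmul, htmul_smul_right]
  map_star' A := htensor_ext_inner fun x y x' y' => by
    rw [ContinuousLinearMap.star_eq_adjoint, ContinuousLinearMap.star_eq_adjoint,
      ContinuousLinearMap.adjoint_inner_right, ampRight_htmul, ampRight_htmul, inner_htmul,
      inner_htmul, ContinuousLinearMap.adjoint_inner_right]

end Tensor

/-! ### Density and continuity of exponential vectors -/

section Fock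

variable {H : Type*} [NormedAddCommGroup H] [InnerProductSpace ℂ H]

/-- Continuous linear maps that agree on exponential vectors are equal. -/
theorem fock_ext {M : Type*} [NormedAddCommGroup M] [NormedSpace ℂ M]
    {A B : Fock H →L[ℂ] M} (h : ∀ f, A (ev f) = B (ev f)) : A = B := by
  refine ContinuousLinearMap.ext_on (s := Set.range ev) ?_ ?_
  · exact Submodule.dense_iff_topologicalClosure_eq_top.2 span_ev_dense
  · rintro _ ⟨f, rfl⟩
    exact h f

/-- Operators with the same matrix elements between exponential vectors are equal. -/
theorem fock_ext_inner {A B : Fock H →L[ℂ] Fock H}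
    (h : ∀ f g, inner ℂ (ev f) (A (ev g)) = inner ℂ (ev f) (B (ev g))) : A = B := by
  refine fock_ext fun g => ?_
  have key : innerSL ℂ (A (ev g)) = innerSL ℂ (B (ev g)) := by
    refine fock_ext fun f => ?_
    rw [innerSL_apply_apply, innerSL_apply_apply, ← inner_conj_symm, h, inner_conj_symm]
  exact ext_inner_right ℂ fun v => by
    simpa only [innerSL_apply_apply] using congrArg (fun T => T v) key

theorem norm_ev_sq (f : H) : ‖ev f‖ ^ 2 = Real.exp (‖f‖ ^ 2) := by
  have h := inner_ev f f
  rw [inner_self_eq_norm_sq_to_K, inner_self_eq_norm_sq_to_K] at h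
  refine Complex.ofReal_injective ?_
  push_cast
  exact h

theorem norm_ev_zero : ‖ev (0 : H)‖ = 1 := by
  have h := norm_ev_sq (0 : H)
  rw [norm_zero] at h
  simp only [ne_eq, OfNat.ofNat_ne_zero, not_false_eq_true, zero_pow, Real.exp_zero] at h
  exact (pow_eq_one_iff_of_nonneg (norm_nonneg _) two_ne_zero).1 h

/-- Expanding the square, ‖ε(g) - ε(f)‖² is an explicit continuous function of g that vanishes at g
= f. -/
theorem continuous_ev : Continuous (ev : H → Fock H) := by
  refine continuous_iff_continuousAt.2 fun f => ?_
  rw [ContinuousAt, tendsto_iff_norm_sub_tendsto_zero]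
  have h : ∀ g, ‖ev g - ev f‖ ^ 2 =
      Real.exp (‖g‖ ^ 2) - 2 * (Complex.exp (inner ℂ g f)).re + Real.exp (‖f‖ ^ 2) := by
    intro g
    rw [@norm_sub_sq ℂ, norm_ev_sq, norm_ev_sq, inner_ev]
    rfl
  have h2 : Tendsto (fun g => ‖ev g - ev f‖ ^ 2) (𝓝 f) (𝓝 0) := by
    have hc : Continuous fun g : H => ‖ev g - ev f‖ ^ 2 := by
      simp only [h]
      fun_prop
    have := hc.tendsto f
    simpa using this
  have h3 := h2.sqrt
  simpa using h3

end Fock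

/-! ### The CCR flow as a unital star homomorphism -/

section Flow

variable {k : Type u} [NormedAddCommGroup k] [InnerProductSpace ℂ k]

theorem split_preOp (t : ℝ≥0) (A : FPre k t →L[ℂ] FPre k t) (x : F k) :
    split k t (preOp t A x) = ampLeft _ A (split k t x) := by
  simp [preOp]

theorem split_postOp (t : ℝ≥0) (B : FPost k t →L[ℂ] FPost k t) (x : F k) :
    split k t (postOp t B x) = ampRight _ B (split k t x) := by
  simp [postOp]

theorem commute_preOp_postOp (t : ℝ≥0) (A : FPre k t →L[ℂ] FPre k t)
    (B : FPost k t →L[ℂ] FPost k t) : Commute (preOp t A) (postOp t B) := by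
  ext x
  apply (split k t).injective
  simp only [mul_apply_eq_comp, split_preOp, split_postOp]
  exact congrArg (fun T => T (split k t x)) (commute_ampLeft_ampRight A B)

/-- The CCR flow as a unital `*`-homomorphism. -/
noncomputable def ccrFlowHom (t : ℝ≥0) : (F k →L[ℂ] F k) →⋆ₐ[ℂ] (F k →L[ℂ] F k) :=
  ((split k t).symm.conjStarAlgEquiv.toStarAlgHom.comp (ampRightHom (FPre k t))).comp
    (GamOnto k t).conjStarAlgEquiv.toStarAlgHom

theorem ccrFlowHom_apply (t : ℝ≥0) (X : F k →L[ℂ] F k) : ccrFlowHom t X = ccrFlow t X := by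
  ext x
  rfl

/-- Star homomorphisms of C*-algebras are contractive. This uniform bound lets limits be tested on
exponential vectors. -/
theorem norm_ccrFlow_le (t : ℝ≥0) (X : F k →L[ℂ] F k) : ‖ccrFlow t X‖ ≤ ‖X‖ := by
  rw [← ccrFlowHom_apply]
  exact NonUnitalStarAlgHom.norm_apply_le _ _

end Flow

/-! ### The shift semigroup on `L²(ℝ₊; k)` and its adjoint -/

section LeftShift

variable {k : Type u} [NormedAddCommGroup k] [InnerProductSpace ℂ k]

theorem resL2_coeFn (A : Set ℝ) (f : L2 k) : resL2 A f =ᵐ[lam.restrict A] f :=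
  LpToLpRestrictCLM_coeFn ℂ A f

theorem resL2_Ici_shift (t : ℝ≥0) (f : L2 k) :
    resL2 (Set.Ici (t : ℝ)) (shift k t f) = shiftOnto k t f := by
  refine Lp.ext ?_
  filter_upwards [resL2_coeFn (Set.Ici (t : ℝ)) (shift k t f),
    ae_restrict_of_ae (extZero_coeFn t (shiftOnto k t f)), ae_restrict_mem measurableSet_Ici]
    with s h1 h2 h3
  rw [h1]
  exact h2.trans (Set.indicator_of_mem h3 _)

theorem resL2_Ico_shift (t : ℝ≥0) (f : L2 k) :
    resL2 (Set.Ico 0 (t : ℝ)) (shift k t f) = 0 := by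
  refine Lp.ext ?_
  filter_upwards [resL2_coeFn (Set.Ico 0 (t : ℝ)) (shift k t f),
    ae_restrict_of_ae (extZero_coeFn t (shiftOnto k t f)), ae_restrict_mem measurableSet_Ico,
    Lp.coeFn_zero k 2 (lam.restrict (Set.Ico 0 (t : ℝ)))]
    with s h1 h2 h3 h4
  rw [h1, h4]
  exact h2.trans (Set.indicator_of_notMem (fun h => absurd h3.2 (not_lt.2 h)) _)

theorem shift_add (s t : ℝ≥0) (f : L2 k) : shift k (s + t) f = shift k s (shift k t f) := by
  refine Lp.ext ?_
  filter_upwards [shift_coeFn k (s + t) f, shift_coeFn k s (shift k t f),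
    ae_of_restrict_Ici ((measurePreserving_sub s).quasiMeasurePreserving.ae (shift_coeFn k t f))]
    with x h1 h2 h3
  rw [h1, h2]
  by_cases hx : (s : ℝ) ≤ x
  · rw [if_pos hx, h3 hx, NNReal.coe_add]
    have e : (s : ℝ) + t ≤ x ↔ (t : ℝ) ≤ x - s := by
      constructor <;> intro h <;> linarith
    simp only [e, sub_sub]
  · rw [if_neg hx, if_neg]
    intro h
    push_cast at h
    exact hx (by linarith [t.coe_nonneg])

variable (k) in
/-- The left shift `f ↦ f(· + t)` on `L²(ℝ₊; k)`, the adjoint of the right shift. -/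
noncomputable def leftShift (t : ℝ≥0) : L2 k →L[ℂ] L2 k :=
  ((shiftOnto k t).symm : L2On k (Set.Ici (t : ℝ)) →L[ℂ] L2 k) ∘L resL2 (Set.Ici (t : ℝ))

theorem shiftOnto_leftShift (t : ℝ≥0) (f : L2 k) :
    shiftOnto k t (leftShift k t f) = resL2 (Set.Ici (t : ℝ)) f :=
  (shiftOnto k t).apply_symm_apply _

theorem inner_shift_left (t : ℝ≥0) (f g : L2 k) :
    inner ℂ (shift k t f) g = inner ℂ f (leftShift k t g) := by
  rw [← inner_split t, resL2_Ico_shift, inner_zero_left, zero_add, resL2_Ici_shift,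
    ← shiftOnto_leftShift, LinearIsometryEquiv.inner_map_map]

/-- Eliminates the spaces over [0, t), which vary with t: only inner products in the fixed space
L²(ℝ₊; k) remain, so continuity in t can be discussed. -/
theorem inner_res_Ico (t : ℝ≥0) (f g : L2 k) :
    inner ℂ (resL2 (Set.Ico 0 (t : ℝ)) f) (resL2 (Set.Ico 0 (t : ℝ)) g) =
      inner ℂ f g - inner ℂ (leftShift k t f) (leftShift k t g) := by
  rw [← inner_split t f g, ← shiftOnto_leftShift, ← shiftOnto_leftShift,
    LinearIsometryEquiv.inner_map_map, add_sub_cancel_right]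

theorem leftShift_add (s t : ℝ≥0) (f : L2 k) :
    leftShift k (s + t) f = leftShift k t (leftShift k s f) := by
  refine ext_inner_left ℂ fun g => ?_
  rw [← inner_shift_left, ← inner_shift_left, ← inner_shift_left, shift_add]

/-- Cauchy–Schwarz for ⟨θ_t θ_t^* f, f⟩ = ‖θ_t^* f‖², with θ_t isometric. -/
theorem norm_leftShift_le (t : ℝ≥0) (f : L2 k) : ‖leftShift k t f‖ ≤ ‖f‖ := by
  have h : RCLike.re (inner ℂ (shift k t (leftShift k t f)) f) = ‖leftShift k t f‖ ^ 2 := by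
    rw [inner_shift_left, inner_self_eq_norm_sq]
  have h2 := re_inner_le_norm (𝕜 := ℂ) (shift k t (leftShift k t f)) f
  rw [h, (shift k t).norm_map] at h2
  nlinarith [norm_nonneg (leftShift k t f), norm_nonneg f]

/-- Extension by zero from `L²(ℝ₊; k)` to `L²(ℝ; k)`. -/
noncomputable def extLine (f : L2 k) : Lp k 2 (volume : Measure ℝ) :=
  ((memLp_indicator_iff_restrict measurableSet_Ici).2 (Lp.memLp f)).toLp
    ((Set.Ici (0 : ℝ)).indicator f)

set_option linter.unusedSectionVars false in
theorem extLine_coeFn (f : L2 k) : extLine f =ᵐ[volume] (Set.Ici (0 : ℝ)).indicator f :=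
  MemLp.coeFn_toLp _

/-- Extend f by zero to the whole line. There the shift is composition with a translation, hence
continuous in t, and θ_t f - f is the restriction to ℝ₊ of the corresponding difference. -/
theorem tendsto_shift_zero (f : L2 k) : Tendsto (fun t => shift k t f) (𝓝 0) (𝓝 f) := by
  have hmp : ∀ t : ℝ≥0, MeasurePreserving (fun s : ℝ => s - t) volume volume := fun t =>
    measurePreserving_sub_right volume (t : ℝ)
  let g : ℝ≥0 → C(ℝ, ℝ) := fun t => ⟨fun s => s - t, by fun_prop⟩
  have hg : Continuous g :=
    ContinuousMap.continuous_of_continuous_uncurry _ (by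
      unfold Function.uncurry
      simp only [g, ContinuousMap.coe_mk]
      fun_prop)
  have hc : Continuous fun t => Lp.compMeasurePreserving (g t) (hmp t) (extLine f) :=
    continuous_const.compMeasurePreservingLp hg hmp (by simp)
  have h0 : Lp.compMeasurePreserving (g 0) (hmp 0) (extLine f) = extLine f := by
    refine Lp.ext ((Lp.coeFn_compMeasurePreserving _ (hmp 0)).trans ?_)
    refine Eventually.of_forall fun s => ?_
    simp
  have h1 := hc.tendsto 0
  rw [h0, tendsto_iff_norm_sub_tendsto_zero] at h1
  rw [tendsto_iff_norm_sub_tendsto_zero]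
  refine squeeze_zero (fun _ => norm_nonneg _) (fun t => ?_) h1
  rw [Lp.norm_def, Lp.norm_def]
  refine ENNReal.toReal_mono (Lp.eLpNorm_ne_top _) ?_
  refine le_trans (le_of_eq (eLpNorm_congr_ae ?_))
    (eLpNorm_mono_measure _ (Measure.restrict_le_self (s := Set.Ici (0 : ℝ))))
  have e1 : ∀ᵐ s ∂lam, Lp.compMeasurePreserving (g t) (hmp t) (extLine f) s = extLine f (s - t) :=
    ae_restrict_of_ae (Lp.coeFn_compMeasurePreserving (extLine f) (hmp t))
  have e2 : ∀ᵐ s ∂lam, extLine f (s - t) = (Set.Ici (0 : ℝ)).indicator f (s - t) :=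
    ae_restrict_of_ae ((hmp t).quasiMeasurePreserving.ae (extLine_coeFn f))
  filter_upwards [Lp.coeFn_sub (shift k t f) f, shift_coeFn k t f, lam_ae_nonneg, e1, e2,
    ae_restrict_of_ae (s := Set.Ici (0 : ℝ)) (extLine_coeFn f),
    ae_restrict_of_ae (s := Set.Ici (0 : ℝ))
      (Lp.coeFn_sub (Lp.compMeasurePreserving (g t) (hmp t) (extLine f)) (extLine f))]
    with s a1 a2 a3 a4 a5 a6 a7
  rw [a1, a7, Pi.sub_apply, Pi.sub_apply, a2, a4, a5, a6,
    Set.indicator_of_mem (Set.mem_Ici.2 a3), Set.indicator_apply]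
  simp only [Set.mem_Ici, sub_nonneg]

/-- Continuity passes to the adjoint because θ_t^* is a contraction: ‖θ_t^* f - f‖² ≤ 2‖f‖² - 2
Re⟨θ_t f, f⟩ = 2 Re⟨f - θ_t f, f⟩. -/
theorem tendsto_leftShift_zero (f : L2 k) : Tendsto (fun t => leftShift k t f) (𝓝 0) (𝓝 f) := by
  rw [tendsto_iff_norm_sub_tendsto_zero]
  have h : ∀ t, ‖leftShift k t f - f‖ ^ 2 ≤ 2 * ‖f‖ * ‖shift k t f - f‖ := by
    intro t
    have h1 := norm_leftShift_le t f
    have h2 : RCLike.re (inner ℂ (leftShift k t f) f) = RCLike.re (inner ℂ (shift k t f) f) := by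
      rw [inner_shift_left, inner_re_symm]
    have h3 := re_inner_le_norm (𝕜 := ℂ) (f - shift k t f) f
    rw [inner_sub_left, map_sub, inner_self_eq_norm_sq, norm_sub_rev] at h3
    rw [@norm_sub_sq ℂ, h2]
    nlinarith [norm_nonneg (leftShift k t f), norm_nonneg f]
  have h2 : Tendsto (fun t => 2 * ‖f‖ * ‖shift k t f - f‖) (𝓝 0) (𝓝 0) := by
    simpa using (tendsto_iff_norm_sub_tendsto_zero.1 (tendsto_shift_zero f)).const_mul (2 * ‖f‖)
  have h3 := (squeeze_zero (fun _ => sq_nonneg _) h h2).sqrt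
  simpa using h3

theorem continuous_leftShift (f : L2 k) : Continuous fun t => leftShift k t f := by
  have key : ∀ s t : ℝ≥0, s ≤ t →
      ‖leftShift k t f - leftShift k s f‖ ≤ ‖leftShift k (t - s) f - f‖ := by
    intro s t h
    obtain ⟨r, rfl⟩ := exists_add_of_le h
    rw [add_tsub_cancel_left, add_comm, leftShift_add, ← map_sub]
    exact norm_leftShift_le s _
  refine continuous_iff_continuousAt.2 fun s => ?_
  rw [ContinuousAt, tendsto_iff_norm_sub_tendsto_zero]
  -- With truncated subtraction this sum is |t - s|; one of the two terms always vanishes.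
  have h1 : Tendsto (fun t : ℝ≥0 => (t - s) + (s - t)) (𝓝 s) (𝓝 0) := by
    have : Continuous fun t : ℝ≥0 => (t - s) + (s - t) := by fun_prop
    simpa using this.tendsto s
  have h2 := tendsto_iff_norm_sub_tendsto_zero.1 ((tendsto_leftShift_zero f).comp h1)
  refine squeeze_zero (fun _ => norm_nonneg _) (fun t => ?_) h2
  rcases le_total s t with h | h
  · simpa [tsub_eq_zero_of_le h] using key s t h
  · rw [norm_sub_rev]
    simpa [tsub_eq_zero_of_le h] using key t s h

end LeftShift

/-! ### Semigroup laws and strong continuity of the flow and of the Fock space shift -/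

section FlowProperties

variable {k : Type u} [NormedAddCommGroup k] [InnerProductSpace ℂ k]

theorem GamOnto_ev (t : ℝ≥0) (f : L2 k) : GamOnto k t (ev f) = ev (shiftOnto k t f) :=
  secondQuantEquiv_ev _ _

theorem GamOnto_symm_ev_res (t : ℝ≥0) (f : L2 k) :
    (GamOnto k t).symm (ev (resL2 (Set.Ici (t : ℝ)) f)) = ev (leftShift k t f) := by
  rw [LinearIsometryEquiv.symm_apply_eq, GamOnto_ev, shiftOnto_leftShift]

theorem split_ccrFlow_ev (t : ℝ≥0) (X : F k →L[ℂ] F k) (f : L2 k) :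
    split k t (ccrFlow t X (ev f)) =
      htmul (ev (resL2 (Set.Ico 0 (t : ℝ)) f)) (GamOnto k t (X (ev (leftShift k t f)))) := by
  rw [ccrFlow, split_postOp, split_ev, ampRight_htmul]
  simp only [ContinuousLinearMap.comp_apply, LinearIsometryEquiv.coe_coe'']
  rw [GamOnto_symm_ev_res]

/-- The F_{t)} factor contributes the exponential of ⟨f, g⟩ over [0, t), and the unitary Γ_t brings
the F_{[t} factor back to F. These matrix elements determine σ_t(X) and yield both the semigroup law
and weak continuity. -/
theorem inner_ccrFlow_ev (t : ℝ≥0) (X : F k →L[ℂ] F k) (f g : L2 k) :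
    inner ℂ (ev f) (ccrFlow t X (ev g)) =
      Complex.exp (inner ℂ f g - inner ℂ (leftShift k t f) (leftShift k t g)) *
        inner ℂ (ev (leftShift k t f)) (X (ev (leftShift k t g))) := by
  rw [← (split k t).inner_map_map, split_ccrFlow_ev, split_ev, inner_htmul, inner_ev,
    inner_res_Ico, ← shiftOnto_leftShift, ← GamOnto_ev, LinearIsometryEquiv.inner_map_map]

theorem ccrFlow_add (s t : ℝ≥0) (X : F k →L[ℂ] F k) :
    ccrFlow (s + t) X = ccrFlow s (ccrFlow t X) := by
  refine fock_ext_inner fun f g => ?_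
  rw [inner_ccrFlow_ev, inner_ccrFlow_ev, inner_ccrFlow_ev, leftShift_add, leftShift_add,
    ← mul_assoc, ← Complex.exp_add, sub_add_sub_cancel]

theorem ccrFlow_mul (t : ℝ≥0) (X Y : F k →L[ℂ] F k) :
    ccrFlow t (X * Y) = ccrFlow t X * ccrFlow t Y := by
  simp only [← ccrFlowHom_apply, map_mul]

theorem ccrFlow_star (t : ℝ≥0) (X : F k →L[ℂ] F k) :
    ccrFlow t (star X) = star (ccrFlow t X) := by
  simp only [← ccrFlowHom_apply, map_star]

theorem ccrFlow_sub (t : ℝ≥0) (X Y : F k →L[ℂ] F k) :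
    ccrFlow t (X - Y) = ccrFlow t X - ccrFlow t Y := by
  simp only [← ccrFlowHom_apply, map_sub]

/-- Turns norms into matrix elements, so that weak continuity for X*X controls the norms for X. -/
theorem norm_ccrFlow_apply_sq (t : ℝ≥0) (X : F k →L[ℂ] F k) (x : F k) :
    ‖ccrFlow t X x‖ ^ 2 = RCLike.re (inner ℂ x (ccrFlow t (star X * X) x)) := by
  rw [ccrFlow_mul, ccrFlow_star, ContinuousLinearMap.star_eq_adjoint, mul_apply_eq_comp,
    ContinuousLinearMap.adjoint_inner_right, inner_self_eq_norm_sq]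

/-- Strong convergence of a uniformly bounded family of operators on Fock space may be tested on
exponential vectors. -/
theorem tendsto_of_tendsto_ev {ι M : Type*} [NormedAddCommGroup M] [NormedSpace ℂ M]
    {H : Type*} [NormedAddCommGroup H] [InnerProductSpace ℂ H]
    {l : Filter ι} {T : ι → Fock H →L[ℂ] M} {A : Fock H →L[ℂ] M} {C : ℝ} (hC : ∀ i, ‖T i‖ ≤ C)
    (h : ∀ f, Tendsto (fun i => T i (ev f)) l (𝓝 (A (ev f)))) (x : Fock H) :
    Tendsto (fun i => T i x) l (𝓝 (A x)) := by
  have hd : Dense (Submodule.span ℂ (Set.range (ev (H := H))) : Set (Fock H)) :=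
    Submodule.dense_iff_topologicalClosure_eq_top.2 span_ev_dense
  have hs : ∀ y ∈ Submodule.span ℂ (Set.range (ev (H := H))),
      Tendsto (fun i => T i y) l (𝓝 (A y)) := by
    intro y hy
    induction hy using Submodule.span_induction with
    | mem y hy => obtain ⟨f, rfl⟩ := hy; exact h f
    | zero => simpa using tendsto_const_nhds
    | add y y' _ _ h1 h2 => simpa using h1.add h2
    | smul c y _ h1 => simpa using h1.const_smul c
  rw [Metric.tendsto_nhds]
  intro ε hε
  -- The absolute value covers an empty index type, where `hC` does not force C ≥ 0.
  have hC0 : 0 < |C| + ‖A‖ + 1 := by positivity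
  obtain ⟨y, hy, hxy⟩ := Metric.mem_closure_iff.1 (hd x) (ε / 2 / (|C| + ‖A‖ + 1)) (by positivity)
  rw [dist_eq_norm, lt_div_iff₀ hC0] at hxy
  filter_upwards [Metric.tendsto_nhds.1 (hs y hy) (ε / 2) (by positivity)] with i hi
  rw [dist_eq_norm] at hi ⊢
  have e : T i x - A x = (T i - A) (x - y) + (T i y - A y) := by
    simp only [_root_.sub_apply, map_sub]; abel
  have b : ‖(T i - A) (x - y)‖ ≤ (|C| + ‖A‖) * ‖x - y‖ :=
    ((T i - A).le_opNorm _).trans (by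
      gcongr
      exact (norm_sub_le _ _).trans (by gcongr; exact (hC i).trans (le_abs_self C)))
  rw [e]
  calc _ ≤ ‖(T i - A) (x - y)‖ + ‖T i y - A y‖ := norm_add_le _ _
    _ < ε := by nlinarith [norm_nonneg (x - y)]

/-- Density of exponential vectors is used twice, first in y with x = ε(f) and then in x. On
exponential vectors the matrix element formula depends continuously on θ_h^* f and θ_h^* g. -/
theorem tendsto_inner_ccrFlow (X : F k →L[ℂ] F k) (x y : F k) :
    Tendsto (fun h => inner ℂ x (ccrFlow h X y)) (𝓝 0) (𝓝 (inner ℂ x (X y))) := by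
  have key : ∀ f : L2 k, Tendsto (fun h => inner ℂ (ev f) (ccrFlow h X y)) (𝓝 0)
      (𝓝 (inner ℂ (ev f) (X y))) := by
    intro f
    have := tendsto_of_tendsto_ev (l := 𝓝 (0 : ℝ≥0))
      (T := fun h => (innerSL ℂ (ev f)) ∘L ccrFlow h X) (A := (innerSL ℂ (ev f)) ∘L X)
      (C := ‖innerSL ℂ (ev f)‖ * ‖X‖) (fun h => (ContinuousLinearMap.opNorm_comp_le _ _).trans
        (by gcongr; exact norm_ccrFlow_le h X)) (fun g => ?_) y
    · simpa using this
    · simp only [ContinuousLinearMap.comp_apply, innerSL_apply_apply, inner_ccrFlow_ev]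
      have hf := tendsto_leftShift_zero f
      have hg := tendsto_leftShift_zero g
      have e : inner ℂ (ev f) (X (ev g)) =
          Complex.exp (inner ℂ f g - inner ℂ f g) * inner ℂ (ev f) (X (ev g)) := by simp
      rw [e]
      refine Tendsto.mul ?_ ?_
      · exact (Complex.continuous_exp.tendsto _).comp (tendsto_const_nhds.sub (hf.inner hg))
      · exact ((continuous_ev.tendsto f).comp hf).inner
          ((X.continuous.tendsto _).comp ((continuous_ev.tendsto g).comp hg))
  have := tendsto_of_tendsto_ev (l := 𝓝 (0 : ℝ≥0)) (T := fun h => innerSL ℂ (ccrFlow h X y))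
    (A := innerSL ℂ (X y)) (C := ‖X‖ * ‖y‖) (fun h => by
      rw [innerSL_apply_norm]
      exact ContinuousLinearMap.le_of_opNorm_le _ (norm_ccrFlow_le h X) y) (fun f => ?_) x
  · simp only [innerSL_apply_apply] at this
    have h2 := (Complex.continuous_conj.tendsto _).comp this
    simpa only [Function.comp_def, inner_conj_symm] using h2
  · simp only [innerSL_apply_apply]
    have h2 := (Complex.continuous_conj.tendsto _).comp (key f)
    simpa only [Function.comp_def, inner_conj_symm] using h2

/-- Weak convergence together with convergence of norms implies strong convergence in a Hilbert
space. -/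
theorem tendsto_ccrFlow (X : F k →L[ℂ] F k) (x : F k) :
    Tendsto (fun h => ccrFlow h X x) (𝓝 0) (𝓝 (X x)) := by
  rw [tendsto_iff_norm_sub_tendsto_zero]
  have h1 : Tendsto (fun h => ‖ccrFlow h X x‖ ^ 2) (𝓝 0) (𝓝 (‖X x‖ ^ 2)) := by
    simp only [norm_ccrFlow_apply_sq]
    have := (RCLike.continuous_re.tendsto _).comp (tendsto_inner_ccrFlow (star X * X) x x)
    rw [mul_apply_eq_comp, ContinuousLinearMap.star_eq_adjoint,
      ContinuousLinearMap.adjoint_inner_right, inner_self_eq_norm_sq] at this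
    exact this
  have h2 : Tendsto (fun h => RCLike.re (inner ℂ (X x) (ccrFlow h X x))) (𝓝 0)
      (𝓝 (‖X x‖ ^ 2)) := by
    have := (RCLike.continuous_re.tendsto _).comp (tendsto_inner_ccrFlow X (X x) x)
    rw [inner_self_eq_norm_sq] at this
    exact this
  have h3 : Tendsto (fun h => ‖ccrFlow h X x - X x‖ ^ 2) (𝓝 0) (𝓝 0) := by
    have e : ∀ h, ‖ccrFlow h X x - X x‖ ^ 2 = ‖X x‖ ^ 2 -
        2 * RCLike.re (inner ℂ (X x) (ccrFlow h X x)) + ‖ccrFlow h X x‖ ^ 2 := fun h => by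
      rw [norm_sub_rev, @norm_sub_sq ℂ]
    simp only [e]
    have := (h2.const_mul 2).const_sub (‖X x‖ ^ 2) |>.add h1
    convert this using 2
    ring
  simpa using h3.sqrt

/-- The difference `X - σ_h(X)` is small on the compact set `{ε(θ_t^* f) : t ≤ T}` for small
`h`. -/
theorem exists_norm_sub_ccrFlow_le (X : F k →L[ℂ] F k) (f : L2 k) (T : ℝ≥0) {η : ℝ}
    (hη : 0 < η) : ∃ δ : ℝ≥0, 0 < δ ∧ ∀ h ≤ δ, ∀ t ≤ T,
      ‖(X - ccrFlow h X) (ev (leftShift k t f))‖ ≤ η := by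
  have hK : IsCompact (Set.Iic T) := by
    rw [← Set.Icc_bot]
    exact isCompact_Icc
  have key : ∀ᶠ h in 𝓝 (0 : ℝ≥0), ∀ t ∈ Set.Iic T,
      ‖(X - ccrFlow h X) (ev (leftShift k t f))‖ < η := by
    -- Compactness of [0, T] reduces the claim to a neighbourhood of each (0, t). There ε(θ_t^* f)
    -- is frozen, at a cost bounded by ‖X - σ_h(X)‖ ≤ 2‖X‖.
    refine hK.eventually_forall_of_forall_eventually fun t _ => ?_
    have h1 : Tendsto (fun z : ℝ≥0 × ℝ≥0 => ev (leftShift k z.2 f)) (𝓝 (0, t))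
        (𝓝 (ev (leftShift k t f))) :=
      (continuous_ev.comp ((continuous_leftShift f).comp continuous_snd)).tendsto (0, t)
    have h2 : Tendsto (fun z : ℝ≥0 × ℝ≥0 =>
        ‖(X - ccrFlow z.1 X) (ev (leftShift k t f))‖ +
          2 * ‖X‖ * ‖ev (leftShift k z.2 f) - ev (leftShift k t f)‖) (𝓝 (0, t)) (𝓝 0) := by
      have a1 : Tendsto (fun z : ℝ≥0 × ℝ≥0 => (X - ccrFlow z.1 X) (ev (leftShift k t f)))
          (𝓝 (0, t)) (𝓝 0) := by
        have := ((tendsto_ccrFlow X (ev (leftShift k t f))).comp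
          (continuous_fst.tendsto ((0 : ℝ≥0), t))).const_sub (X (ev (leftShift k t f)))
        simpa using this
      have a2 := (tendsto_iff_norm_sub_tendsto_zero.1 h1).const_mul (2 * ‖X‖)
      simpa using a1.norm.add a2
    filter_upwards [h2.eventually (gt_mem_nhds hη)] with z hz
    refine lt_of_le_of_lt ?_ hz
    have e : (X - ccrFlow z.1 X) (ev (leftShift k z.2 f)) =
        (X - ccrFlow z.1 X) (ev (leftShift k t f)) +
        (X - ccrFlow z.1 X) (ev (leftShift k z.2 f) - ev (leftShift k t f)) := by
      rw [map_sub]; abel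
    rw [e]
    refine (norm_add_le _ _).trans (by
      gcongr
      refine ContinuousLinearMap.le_of_opNorm_le _ ?_ _
      refine (norm_sub_le _ _).trans ?_
      linarith [norm_ccrFlow_le z.1 X])
  obtain ⟨δ, hδ, h⟩ := Metric.eventually_nhds_iff.1 key
  refine ⟨(δ / 2).toNNReal, ?_, fun s hs t ht => (h ?_ t ht).le⟩
  · exact Real.toNNReal_pos.2 (by positivity)
  · rw [NNReal.dist_eq, NNReal.coe_zero, sub_zero, abs_of_nonneg s.coe_nonneg]
    have : (s : ℝ) ≤ δ / 2 := (Real.le_toNNReal_iff_coe_le (by positivity)).1 hs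
    linarith

/-- The right shift `Γ_t` on Fock space for finite `t`. -/
theorem Gam_coe (t : ℝ≥0) :
    Gam k t = (secondQuant (shift k t)).toContinuousLinearMap := by
  rw [Gam, if_neg ENNReal.coe_ne_top, ENNReal.toNNReal_coe]

theorem Gam_coe_ev (t : ℝ≥0) (f : L2 k) : Gam k t (ev f) = ev (shift k t f) := by
  rw [Gam_coe]
  exact secondQuant_ev _ _

theorem norm_Gam_coe (t : ℝ≥0) (x : F k) : ‖Gam k t x‖ = ‖x‖ := by
  rw [Gam_coe]
  exact (secondQuant (shift k t)).norm_map x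

theorem Gam_top : Gam k ∞ = vacProj k := if_pos rfl

theorem ccr_top (X : F k →L[ℂ] F k) : ccr ∞ X = 1 := if_pos rfl

theorem ccr_coe (t : ℝ≥0) (X : F k →L[ℂ] F k) : ccr t X = ccrFlow t X := by
  rw [ccr, if_neg ENNReal.coe_ne_top, ENNReal.toNNReal_coe]

/-- Shifted functions vanish on [0, t), so the F_{t)} component is the vacuum vector. -/
theorem split_Gam (t : ℝ≥0) (x : F k) :
    split k t (Gam k t x) = htmul (ev 0) (GamOnto k t x) := by
  have key : (split k t : F k →L[ℂ] HTensor (FPre k t) (FPost k t)) ∘L Gam k t =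
      htmulRight (ev 0) ∘L (GamOnto k t : F k →L[ℂ] FPost k t) := by
    refine fock_ext fun f => ?_
    simp only [ContinuousLinearMap.comp_apply, LinearIsometryEquiv.coe_coe'', htmulRight_apply]
    rw [Gam_coe_ev, split_ev, resL2_Ico_shift, resL2_Ici_shift, GamOnto_ev]
  exact congrArg (fun T => T x) key

theorem Gam_add (s t : ℝ≥0) : Gam k ↑(s + t) = Gam k s * Gam k t := by
  refine fock_ext fun f => ?_
  rw [Gam_coe_ev, mul_apply_eq_comp, Gam_coe_ev, Gam_coe_ev, shift_add]

theorem ccrFlow_mul_Gam (t : ℝ≥0) (X : F k →L[ℂ] F k) :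
    ccrFlow t X * Gam k t = Gam k t * X := by
  ext x
  apply (split k t).injective
  rw [mul_apply_eq_comp, mul_apply_eq_comp, split_Gam, ccrFlow, split_postOp, split_Gam,
    ampRight_htmul]
  simp

theorem vacProj_ev (f : L2 k) : vacProj k (ev f) = ev 0 := by
  rw [vacProj, Submodule.starProjection_singleton]
  simp [inner_ev, norm_ev_zero]

/-- Γ_t fixes the vacuum. Hence Γ_t x - Γ_∞ x = Γ_t(x - E_0 x), which has the form needed to bound
the unbounded interval. -/
theorem Gam_mul_vacProj (t : ℝ≥0) : Gam k t * vacProj k = vacProj k := by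
  refine fock_ext fun f => ?_
  rw [mul_apply_eq_comp, vacProj_ev, Gam_coe_ev, map_zero]

theorem norm_vacProj_apply_le (x : F k) : ‖vacProj k x‖ ≤ ‖x‖ :=
  Submodule.norm_starProjection_apply_le _ x

theorem tendsto_Gam_zero (x : F k) : Tendsto (fun t : ℝ≥0 => Gam k t x) (𝓝 0) (𝓝 x) := by
  refine tendsto_of_tendsto_ev (T := fun t : ℝ≥0 => Gam k t) (A := 1) (C := 1) (fun t => ?_)
    (fun f => ?_) x
  · refine ContinuousLinearMap.opNorm_le_bound _ zero_le_one fun x => ?_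
    rw [norm_Gam_coe, one_mul]
  · simp only [Gam_coe_ev]
    exact (continuous_ev.tendsto f).comp (tendsto_shift_zero f)

end FlowProperties

/-! ### Orthogonality of projections -/

section Projections

variable {E : Type*} [NormedAddCommGroup E] [InnerProductSpace ℂ E] [CompleteSpace E]

theorem norm_sq_of_isStarProjection {P : E →L[ℂ] E} (hP : IsStarProjection P) (x : E) :
    ‖P x‖ ^ 2 = RCLike.re (inner ℂ x (P x)) := by
  have h : P x = star P (P x) := by
    rw [hP.isSelfAdjoint.star_eq, ← mul_apply_eq_comp, hP.isIdempotentElem.eq]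
  rw [h, ContinuousLinearMap.star_eq_adjoint, ContinuousLinearMap.adjoint_inner_right,
    inner_self_eq_norm_sq, ← ContinuousLinearMap.star_eq_adjoint, ← h]

theorem norm_apply_le_of_isStarProjection {P : E →L[ℂ] E} (hP : IsStarProjection P) (x : E) :
    ‖P x‖ ≤ ‖x‖ := by
  have h1 := norm_sq_of_isStarProjection hP x
  have h2 := re_inner_le_norm (𝕜 := ℂ) x (P x)
  nlinarith [norm_nonneg x, norm_nonneg (P x)]

/-- Idempotence of P + Q gives PQ + QP = 0. Multiplying by P on the left and on the right gives PQ =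
-PQP = QP, hence 2PQ = 0. -/
theorem mul_eq_zero_of_isStarProjection_add {P Q : E →L[ℂ] E} (hP : IsStarProjection P)
    (hQ : IsStarProjection Q) (hPQ : IsStarProjection (P + Q)) : P * Q = 0 := by
  have p := hP.isIdempotentElem.eq
  have q := hQ.isIdempotentElem.eq
  have h : P * Q + Q * P = 0 := by
    have h := hPQ.isIdempotentElem.eq
    rw [add_mul, mul_add, mul_add, p, q] at h
    have h2 : (P + P * Q + (Q * P + Q)) - (P + Q) = 0 := by rw [h, sub_self]
    rw [← h2]; abel
  have h1 : P * Q + P * Q * P = 0 := by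
    have := congrArg (fun T => P * T) h
    simpa only [mul_add, ← mul_assoc, p, mul_zero] using this
  have h2 : P * Q * P + Q * P = 0 := by
    have := congrArg (fun T => T * P) h
    simpa only [add_mul, mul_assoc, p, zero_mul] using this
  have h3 : P * Q = Q * P := by
    rw [eq_neg_of_add_eq_zero_left h1, ← eq_neg_of_add_eq_zero_right h2]
  rw [← h3, ← two_smul ℂ] at h
  exact (smul_eq_zero.1 h).resolve_left two_ne_zero

/-- Pythagoras for mutually orthogonal projections. -/
theorem norm_sum_sq_of_orthogonal {ι : Type*} (s : Finset ι) {P : ι → E →L[ℂ] E}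
    (hP : ∀ i, IsStarProjection (P i)) (hPQ : ∀ i j, i ≠ j → P i * P j = 0) (y : ι → E) :
    ‖∑ i ∈ s, P i (y i)‖ ^ 2 = ∑ i ∈ s, ‖P i (y i)‖ ^ 2 := by
  classical
  induction s using Finset.induction_on with
  | empty => simp
  | insert a s ha ih =>
    rw [Finset.sum_insert ha, Finset.sum_insert ha, ← ih, @norm_add_sq ℂ, inner_sum,
      Finset.sum_eq_zero, map_zero, mul_zero, add_zero]
    intro i hi
    have hai : a ≠ i := fun h => ha (h ▸ hi)
    rw [← ContinuousLinearMap.adjoint_inner_right, ← ContinuousLinearMap.star_eq_adjoint,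
      (hP a).isSelfAdjoint.star_eq, ← mul_apply_eq_comp, hPQ a i hai, _root_.zero_apply,
      inner_zero_right]

end Projections

/-! ### Quantum stop times as spectral measures -/

namespace QuantumStopTime

variable {k : Type u} [NormedAddCommGroup k] [InnerProductSpace ℂ k]
  (S : QuantumStopTime k)

theorem apply_biUnion {ι : Type*} (s : Finset ι) {A : ι → Set ℝ≥0∞}
    (hd : (s : Set ι).PairwiseDisjoint A) (hA : ∀ i ∈ s, MeasurableSet (A i)) :
    S.toFun (⋃ i ∈ s, A i) = ∑ i ∈ s, S.toFun (A i) := by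
  ext y
  refine ext_inner_left ℂ fun x => ?_
  obtain ⟨μ, hμ⟩ := S.isMeasure x y
  rw [← hμ _ (Finset.measurableSet_biUnion s hA), VectorMeasure.of_biUnion_finset hd hA,
    _root_.sum_apply, inner_sum]
  exact Finset.sum_congr rfl fun i hi => hμ _ (hA i hi)

theorem apply_union {A B : Set ℝ≥0∞} (h : Disjoint A B) (hA : MeasurableSet A)
    (hB : MeasurableSet B) : S.toFun (A ∪ B) = S.toFun A + S.toFun B := by
  ext y
  refine ext_inner_left ℂ fun x => ?_
  obtain ⟨μ, hμ⟩ := S.isMeasure x y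
  rw [← hμ _ (hA.union hB), VectorMeasure.of_union h hA hB, hμ _ hA, hμ _ hB, _root_.add_apply,
    inner_add_right]

/-- Orthogonality is not part of the definition; it follows from additivity, since S(A) + S(B) = S(A
∪ B) is itself a projection. -/
theorem mul_eq_zero {A B : Set ℝ≥0∞} (h : Disjoint A B) (hA : MeasurableSet A)
    (hB : MeasurableSet B) : S.toFun A * S.toFun B = 0 :=
  mul_eq_zero_of_isStarProjection_add (S.isProj A hA) (S.isProj B hB)
    (S.apply_union h hA hB ▸ S.isProj _ (hA.union hB))

theorem norm_apply_mono {A B : Set ℝ≥0∞} (h : A ⊆ B) (hA : MeasurableSet A)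
    (hB : MeasurableSet B) (x : F k) : ‖S.toFun A x‖ ≤ ‖S.toFun B x‖ := by
  have h1 : S.toFun B = S.toFun A + S.toFun (B \ A) := by
    rw [← S.apply_union Set.disjoint_sdiff_right hA (hB.diff hA), Set.union_sdiff_cancel h]
  have h2 : S.toFun A x = S.toFun A (S.toFun B x) := by
    rw [← mul_apply_eq_comp, h1, mul_add, S.mul_eq_zero Set.disjoint_sdiff_right hA (hB.diff hA),
      add_zero, (S.isProj A hA).isIdempotentElem.eq]
  rw [h2]
  exact norm_apply_le_of_isStarProjection (S.isProj A hA) _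

/-- Continuity from above: the sets (n, ∞] decrease to {∞}, and ‖S(A)x‖² is the value at A of the
measure for the pair (x, x). -/
theorem tendsto_apply_Ioi (h : S.toFun {∞} = 0) (x : F k) :
    Tendsto (fun n : ℕ => ‖S.toFun (Set.Ioi (n : ℝ≥0∞)) x‖) atTop (𝓝 0) := by
  obtain ⟨μ, hμ⟩ := S.isMeasure x x
  have h1 := μ.tendsto_vectorMeasure_iInter_atTop_nat
    (s := fun n : ℕ => Set.Ioi (n : ℝ≥0∞)) (fun m n hmn =>
      Set.Ioi_subset_Ioi (by exact_mod_cast hmn)) (fun n => measurableSet_Ioi)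
  have e : ⋂ n : ℕ, Set.Ioi (n : ℝ≥0∞) = {∞} := by
    ext t
    simp only [Set.mem_iInter, Set.mem_Ioi, Set.mem_singleton_iff]
    refine ⟨fun ht => ?_, fun ht n => ht ▸ ENNReal.natCast_lt_top n⟩
    by_contra hne
    obtain ⟨n, hn⟩ := ENNReal.exists_nat_gt hne
    exact lt_asymm hn (ht n)
  rw [e, hμ _ (measurableSet_singleton _), h, _root_.zero_apply, inner_zero_right] at h1
  have h2 := ((RCLike.continuous_re.tendsto _).comp h1).sqrt
  rw [map_zero, Real.sqrt_zero] at h2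
  refine h2.congr fun n => ?_
  rw [Function.comp_apply, hμ _ measurableSet_Ioi,
    ← norm_sq_of_isStarProjection (S.isProj _ measurableSet_Ioi), Real.sqrt_sq (norm_nonneg _)]

/-- Reduces increments to the projections S([0, t]), for which adaptedness is assumed. -/
theorem apply_Ioc {s t : ℝ≥0∞} (h : s ≤ t) :
    S.toFun (Set.Ioc s t) = S.toFun (Set.Icc 0 t) - S.toFun (Set.Icc 0 s) := by
  rw [← Set.Icc_union_Ioc_eq_Icc zero_le h, S.apply_union _ measurableSet_Icc measurableSet_Ioc,
    add_sub_cancel_left]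
  exact Set.disjoint_left.2 fun x h1 h2 => not_le.2 h2.1 h1.2

theorem apply_Ioc_zero_top (h : S.toFun {0} = 0) : S.toFun (Set.Ioc 0 ∞) = 1 := by
  rw [S.apply_Ioc zero_le, Set.Icc_self, h, sub_zero, ← S.map_univ]
  congr 1
  ext x
  simp

/-- The spectral projection `S([0, s])` acts on `F_{s)}` only. -/
theorem exists_preOp (s : ℝ≥0) : ∃ A, S.toFun (Set.Icc 0 (s : ℝ≥0∞)) = preOp s A := by
  rcases eq_zero_or_pos s with rfl | hs
  · obtain ⟨c, hc⟩ := S.adapted_zero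
    refine ⟨c • 1, ?_⟩
    rw [ENNReal.coe_zero, Set.Icc_self, hc]
    ext x
    apply (split k 0).injective
    have e : ampLeft (FPost k 0) (c • (1 : FPre k 0 →L[ℂ] FPre k 0)) = c • 1 :=
      htensor_ext fun x y => by
        rw [ampLeft_htmul, _root_.smul_apply, _root_.smul_apply, one_apply_eq_self,
          one_apply_eq_self, htmul_smul_left]
    rw [split_preOp, e, _root_.smul_apply, _root_.smul_apply, one_apply_eq_self,
      one_apply_eq_self, map_smul]
  · exact S.adapted s hs

end QuantumStopTime

/-! ### Operators on the past against the flow and the shift -/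

section Adapted

variable {k : Type u} [NormedAddCommGroup k] [InnerProductSpace ℂ k]

/-- Since σ_t = σ_s ∘ σ_{t-s}, the operator σ_t(X) also acts only on F_{[s}; no comparison of the
decompositions at s and t is needed. -/
theorem commute_preOp_ccrFlow {s t : ℝ≥0} (h : s ≤ t) (A : FPre k s →L[ℂ] FPre k s)
    (X : F k →L[ℂ] F k) : Commute (preOp s A) (ccrFlow t X) := by
  obtain ⟨r, rfl⟩ := exists_add_of_le h
  rw [ccrFlow_add]
  exact commute_preOp_postOp s A _

/-- At s = t everything splits over the two tensor factors; the exponential is ‖ε(θ_t^* f)‖² and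
avoids a division. For s < t apply this at s to σ_{t-s}(Y) and insert its matrix elements. -/
theorem inner_preOp_ccrFlow {s t : ℝ≥0} (h : s ≤ t) (A : FPre k s →L[ℂ] FPre k s)
    (Y : F k →L[ℂ] F k) (f : L2 k) :
    inner ℂ (ev f) (preOp s A (ccrFlow t Y (ev f))) *
        Complex.exp (inner ℂ (leftShift k t f) (leftShift k t f)) =
      inner ℂ (ev f) (preOp s A (ev f)) *
        inner ℂ (ev (leftShift k t f)) (Y (ev (leftShift k t f))) := by
  have base : ∀ Z : F k →L[ℂ] F k, inner ℂ (ev f) (preOp s A (ccrFlow s Z (ev f))) *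
        Complex.exp (inner ℂ (leftShift k s f) (leftShift k s f)) =
      inner ℂ (ev f) (preOp s A (ev f)) *
        inner ℂ (ev (leftShift k s f)) (Z (ev (leftShift k s f))) := by
    intro Z
    rw [← (split k s).inner_map_map, split_preOp, split_ccrFlow_ev, split_ev, ampLeft_htmul,
      inner_htmul, ← (split k s).inner_map_map (ev f) (preOp s A (ev f)), split_preOp, split_ev,
      ampLeft_htmul, inner_htmul, ← shiftOnto_leftShift, ← GamOnto_ev,
      LinearIsometryEquiv.inner_map_map, LinearIsometryEquiv.inner_map_map, inner_ev]
    ring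
  obtain ⟨r, rfl⟩ := exists_add_of_le h
  have b := base (ccrFlow r Y)
  rw [inner_ccrFlow_ev, ← ccrFlow_add, ← leftShift_add, Complex.exp_sub] at b
  have n1 := Complex.exp_ne_zero (inner ℂ (leftShift k s f) (leftShift k s f))
  have n2 := Complex.exp_ne_zero (inner ℂ (leftShift k (s + r) f) (leftShift k (s + r) f))
  field_simp at b
  linear_combination b

/-- Γ_t = Γ_s Γ_{t-s} puts the vacuum in the F_{s)} factor, so A is only tested there. -/
theorem inner_Gam_preOp {s t : ℝ≥0} (h : s ≤ t) (A : FPre k s →L[ℂ] FPre k s) (x y : F k) :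
    inner ℂ (Gam k t x) (preOp s A (Gam k t y)) =
      inner ℂ (ev 0) (preOp s A (ev 0)) * inner ℂ x y := by
  have base : ∀ x y : F k, inner ℂ (Gam k s x) (preOp s A (Gam k s y)) =
      inner ℂ (ev 0) (A (ev 0)) * inner ℂ x y := fun x y => by
    rw [← (split k s).inner_map_map, split_preOp, split_Gam, split_Gam, ampLeft_htmul,
      inner_htmul, LinearIsometryEquiv.inner_map_map]
  have vac : inner ℂ (ev 0) (preOp s A (ev 0)) = inner ℂ (ev 0) (A (ev 0)) := by
    have := base (ev 0) (ev 0)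
    rw [Gam_coe_ev, map_zero, inner_ev, inner_zero_left, Complex.exp_zero, mul_one] at this
    exact this
  obtain ⟨r, rfl⟩ := exists_add_of_le h
  rw [Gam_add, mul_apply_eq_comp, mul_apply_eq_comp, base, vac, Gam_coe r]
  congr 1
  exact (secondQuant (shift k r)).inner_map_map x y

end Adapted

/-! ### Local estimates for increments -/

namespace QuantumStopTime

variable {k : Type u} [NormedAddCommGroup k] [InnerProductSpace ℂ k]
  (S : QuantumStopTime k)

theorem isProj_Ioc (s t : ℝ≥0∞) : IsStarProjection (S.toFun (Set.Ioc s t)) :=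
  S.isProj _ measurableSet_Ioc

theorem commute_Ioc_ccr {s t b : ℝ≥0∞} (hst : s ≤ t) (htb : t ≤ b) (X : F k →L[ℂ] F k) :
    Commute (S.toFun (Set.Ioc s t)) (ccr b X) := by
  rcases eq_or_ne b ∞ with rfl | hb
  · rw [ccr_top]
    exact Commute.one_right _
  · lift b to ℝ≥0 using hb
    lift t to ℝ≥0 using ne_top_of_le_ne_top ENNReal.coe_ne_top htb
    lift s to ℝ≥0 using ne_top_of_le_ne_top ENNReal.coe_ne_top hst
    obtain ⟨A, hA⟩ := S.exists_preOp s
    obtain ⟨B, hB⟩ := S.exists_preOp t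
    rw [ccr_coe, S.apply_Ioc hst, hA, hB]
    norm_cast at hst htb
    exact (commute_preOp_ccrFlow htb B X).sub_left (commute_preOp_ccrFlow (hst.trans htb) A X)

/-- The increment and σ_t(Z) act on different tensor factors, so the squared norm is a product
divided by ‖ε(θ_t^* f)‖² ≥ 1, and that denominator is dropped. The factor ‖S((s,t])ε(f)‖ is what
makes the estimate summable over a partition. -/
theorem norm_Ioc_ccrFlow_ev_le {s t : ℝ≥0} (h : s ≤ t) (Z : F k →L[ℂ] F k) (f : L2 k) :
    ‖S.toFun (Set.Ioc (s : ℝ≥0∞) t) (ccrFlow t Z (ev f))‖ ≤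
      ‖Z (ev (leftShift k t f))‖ * ‖S.toFun (Set.Ioc (s : ℝ≥0∞) t) (ev f)‖ := by
  set P := S.toFun (Set.Ioc (s : ℝ≥0∞) t) with hPdef
  have hP : IsStarProjection P := S.isProj_Ioc _ _
  have hst : (s : ℝ≥0∞) ≤ t := by exact_mod_cast h
  have hc : ∀ Y, Commute P (ccrFlow t Y) := fun Y => by
    rw [← ccr_coe]
    exact S.commute_Ioc_ccr hst le_rfl Y
  obtain ⟨A, hA⟩ := S.exists_preOp s
  obtain ⟨B, hB⟩ := S.exists_preOp t
  have key : inner ℂ (ev f) (P (ccrFlow t (star Z * Z) (ev f))) *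
        Complex.exp (inner ℂ (leftShift k t f) (leftShift k t f)) =
      inner ℂ (ev f) (P (ev f)) *
        inner ℂ (ev (leftShift k t f)) ((star Z * Z) (ev (leftShift k t f))) := by
    rw [hPdef, S.apply_Ioc hst, hA, hB]
    simp only [_root_.sub_apply, inner_sub_right, sub_mul, inner_preOp_ccrFlow h,
      inner_preOp_ccrFlow le_rfl]
  have e1 : inner ℂ (ev f) (P (ccrFlow t (star Z * Z) (ev f))) =
      ((‖P (ccrFlow t Z (ev f))‖ ^ 2 : ℝ) : ℂ) := by
    have h1 : P * ccrFlow t (star Z * Z) = star (P * ccrFlow t Z) * (P * ccrFlow t Z) := by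
      rw [star_mul, hP.isSelfAdjoint.star_eq, ccrFlow_mul, ← ccrFlow_star, ← mul_assoc, ← mul_assoc,
        mul_assoc _ P P, hP.isIdempotentElem.eq, (hc _).eq]
    rw [← mul_apply_eq_comp, h1, mul_apply_eq_comp, ContinuousLinearMap.star_eq_adjoint,
      ContinuousLinearMap.adjoint_inner_right, inner_self_eq_norm_sq_to_K, mul_apply_eq_comp]
    push_cast
    rfl
  have e2 : inner ℂ (ev f) (P (ev f)) = ((‖P (ev f)‖ ^ 2 : ℝ) : ℂ) := by
    have h1 : P = star P * P := by rw [hP.isSelfAdjoint.star_eq, hP.isIdempotentElem.eq]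
    conv_lhs => rw [h1]
    rw [mul_apply_eq_comp, ContinuousLinearMap.star_eq_adjoint,
      ContinuousLinearMap.adjoint_inner_right, inner_self_eq_norm_sq_to_K]
    push_cast
    rfl
  rw [e1, e2, mul_apply_eq_comp, ContinuousLinearMap.star_eq_adjoint,
    ContinuousLinearMap.adjoint_inner_right, inner_self_eq_norm_sq_to_K,
    inner_self_eq_norm_sq_to_K] at key
  have key2 : ‖P (ccrFlow t Z (ev f))‖ ^ 2 * Real.exp (‖leftShift k t f‖ ^ 2) =
      ‖P (ev f)‖ ^ 2 * ‖Z (ev (leftShift k t f))‖ ^ 2 := by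
    refine Complex.ofReal_injective ?_
    push_cast at key ⊢
    exact key
  refine (sq_le_sq₀ (norm_nonneg _) (by positivity)).1 ?_
  have h1 : 1 ≤ Real.exp (‖leftShift k t f‖ ^ 2) := Real.one_le_exp (by positivity)
  nlinarith [sq_nonneg ‖P (ccrFlow t Z (ev f))‖]

theorem norm_Ioc_Gam {s t : ℝ≥0} (h : s ≤ t) (x : F k) :
    ‖S.toFun (Set.Ioc (s : ℝ≥0∞) t) (Gam k t x)‖ =
      ‖S.toFun (Set.Ioc (s : ℝ≥0∞) t) (ev 0)‖ * ‖x‖ := by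
  have hst : (s : ℝ≥0∞) ≤ t := by exact_mod_cast h
  obtain ⟨A, hA⟩ := S.exists_preOp s
  obtain ⟨B, hB⟩ := S.exists_preOp t
  have key : inner ℂ (Gam k t x) (S.toFun (Set.Ioc (s : ℝ≥0∞) t) (Gam k t x)) =
      inner ℂ (ev 0) (S.toFun (Set.Ioc (s : ℝ≥0∞) t) (ev 0)) * inner ℂ x x := by
    rw [S.apply_Ioc hst, hA, hB]
    simp only [_root_.sub_apply, inner_sub_right, sub_mul, inner_Gam_preOp h,
      inner_Gam_preOp le_rfl]
  refine (sq_eq_sq₀ (norm_nonneg _) (by positivity)).1 ?_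
  rw [mul_pow, norm_sq_of_isStarProjection (S.isProj_Ioc _ _),
    norm_sq_of_isStarProjection (S.isProj_Ioc _ _), key, inner_self_eq_norm_sq_to_K]
  norm_cast
  rw [mul_comm, RCLike.re_ofReal_mul, mul_comm]

end QuantumStopTime

/-! ### Combinatorics of partitions and refinement -/

namespace TimePartition

/-- The `j`-th interval of a partition. -/
def interval (p : TimePartition) (j : Fin (p.n + 1)) : Set ℝ≥0∞ :=
  Set.Ioc (p.pt j.castSucc) (p.pt j.succ)

theorem lt_succ (p : TimePartition) (j : Fin (p.n + 1)) : p.pt j.castSucc < p.pt j.succ :=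
  p.strictMono Fin.castSucc_lt_succ

theorem pt_ne_top (p : TimePartition) {m : Fin (p.n + 2)} (hm : m ≠ Fin.last _) :
    p.pt m ≠ ∞ := fun h => hm (p.strictMono.injective (h.trans p.pt_last.symm))

theorem pt_succ_ne_top (p : TimePartition) {j : Fin (p.n + 1)} (hj : j ≠ Fin.last _) :
    p.pt j.succ ≠ ∞ :=
  p.pt_ne_top (by rwa [← Fin.succ_last, (Fin.succ_injective _).ne_iff])

theorem interval_disjoint (p : TimePartition) {i j : Fin (p.n + 1)} (h : i ≠ j) :
    Disjoint (p.interval i) (p.interval j) := by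
  wlog hij : i < j generalizing i j
  · exact (this h.symm (lt_of_le_of_ne (not_lt.1 hij) h.symm)).symm
  refine Set.disjoint_left.2 fun x h1 h2 => not_le.2 h2.1 (h1.2.trans (p.strictMono.monotone ?_))
  exact Fin.succ_le_castSucc_iff.2 hij

theorem exists_mem_interval (p : TimePartition) {t : ℝ≥0∞} (ht : 0 < t) :
    ∃ j, t ∈ p.interval j := by
  obtain ⟨m, h1, h2⟩ : ∃ m, t ≤ p.pt m ∧ ∀ l, l < m → p.pt l < t := by
    have hwf : WellFounded fun a b : Fin (p.n + 2) => a < b := wellFounded_lt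
    obtain ⟨m, hm, hmin⟩ := hwf.has_min {m | t ≤ p.pt m} ⟨Fin.last _, by simp [p.pt_last]⟩
    exact ⟨m, hm, fun l hl => not_le.1 fun h => hmin l h hl⟩
  have h0 : m ≠ 0 := by
    intro h
    rw [h, p.pt_zero] at h1
    exact not_lt.2 h1 ht
  obtain ⟨j, rfl⟩ := Fin.exists_succ_eq.2 h0
  exact ⟨j, h2 _ Fin.castSucc_lt_succ, h1⟩

/-- Each interval of a refinement lies in an interval of the original partition. -/
theorem exists_interval_subset {p q : TimePartition} (h : p ≤ q) (j : Fin (q.n + 1)) :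
    ∃ i : Fin (p.n + 1), p.pt i.castSucc ≤ q.pt j.castSucc ∧ q.pt j.succ ≤ p.pt i.succ := by
  obtain ⟨i, hi1, hi2⟩ := p.exists_mem_interval ((zero_le).trans_lt (q.lt_succ j))
  refine ⟨i, ?_, hi2⟩
  obtain ⟨m, hm⟩ := h ⟨i.castSucc, rfl⟩
  rw [← hm] at hi1 ⊢
  exact q.strictMono.monotone (Fin.le_castSucc_iff.2 (q.strictMono.lt_iff_lt.1 hi1))

theorem last_mono {p q : TimePartition} (h : p ≤ q) :
    p.pt (Fin.last p.n).castSucc ≤ q.pt (Fin.last q.n).castSucc := by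
  obtain ⟨m, hm⟩ := h ⟨(Fin.last p.n).castSucc, rfl⟩
  rw [← hm]
  refine q.strictMono.monotone (Fin.le_castSucc_iff.2 ?_)
  rw [Fin.succ_last]
  refine lt_of_le_of_ne (Fin.le_last _) fun hl => ?_
  rw [hl, q.pt_last] at hm
  exact p.pt_ne_top (Fin.castSucc_lt_last _).ne hm.symm

/-- There are partitions that are arbitrarily fine on a given bounded interval. -/
theorem exists_mesh_le {T δ : ℝ≥0} (hT : 0 < T) (hδ : 0 < δ) :
    ∃ p : TimePartition, T ≤ p.pt (Fin.last p.n).castSucc ∧ ∀ i, i ≠ Fin.last p.n →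
      ∃ a b : ℝ≥0, p.pt i.castSucc = a ∧ p.pt i.succ = b ∧ b ≤ T ∧ b ≤ a + δ := by
  classical
  obtain ⟨N, hN⟩ := exists_nat_gt (T / δ)
  have hN0 : (0 : ℝ≥0) < N := zero_le.trans_lt hN
  have hd0 : 0 < T / N := by positivity
  have hd : T / N ≤ δ := by
    rw [div_lt_iff₀ hδ] at hN
    rw [div_le_iff₀ hN0, mul_comm]
    exact hN.le
  have hNT : (N : ℝ≥0) * (T / N) = T := mul_div_cancel₀ _ hN0.ne'
  -- The partition consists of the multiples 0, T/N, …, T together with ∞.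
  obtain ⟨p, hp⟩ := exists_of_finset
    (insert ∞ ((Finset.range (N + 1)).image fun m : ℕ => (((m : ℝ≥0) * (T / N) : ℝ≥0) : ℝ≥0∞)))
    (Finset.mem_insert_of_mem (Finset.mem_image.2 ⟨0, by simp, by simp⟩))
    (Finset.mem_insert_self _ _)
  have hfin : ∀ m : Fin (p.n + 2), m ≠ Fin.last _ →
      ∃ a ≤ N, p.pt m = (((a : ℝ≥0) * (T / N) : ℝ≥0) : ℝ≥0∞) := by
    intro m hm
    have hmem : p.pt m ∈ Set.range p.pt := ⟨m, rfl⟩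
    rw [hp, Finset.mem_coe, Finset.mem_insert, Finset.mem_image] at hmem
    rcases hmem with h | ⟨a, ha, h⟩
    · exact absurd h (p.pt_ne_top hm)
    · exact ⟨a, Nat.lt_succ_iff.1 (Finset.mem_range.1 ha), h.symm⟩
  have hex : ∀ a ≤ N, ∃ m, p.pt m = (((a : ℝ≥0) * (T / N) : ℝ≥0) : ℝ≥0∞) := by
    intro a ha
    have : (((a : ℝ≥0) * (T / N) : ℝ≥0) : ℝ≥0∞) ∈ Set.range p.pt := by
      rw [hp, Finset.mem_coe]
      exact Finset.mem_insert_of_mem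
        (Finset.mem_image.2 ⟨a, Finset.mem_range.2 (Nat.lt_succ_iff.2 ha), rfl⟩)
    exact this
  refine ⟨p, ?_, fun i hi => ?_⟩
  · obtain ⟨m, hm⟩ := hex N le_rfl
    rw [hNT] at hm
    rw [← hm]
    refine p.strictMono.monotone (Fin.le_castSucc_iff.2 ?_)
    rw [Fin.succ_last]
    refine lt_of_le_of_ne (Fin.le_last _) fun hl => ?_
    rw [hl, p.pt_last] at hm
    exact ENNReal.coe_ne_top hm.symm
  · obtain ⟨a, ha, hpa⟩ := hfin i.castSucc (Fin.castSucc_lt_last _).ne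
    obtain ⟨b, hb, hpb⟩ := hfin i.succ
      (by rwa [← Fin.succ_last, (Fin.succ_injective _).ne_iff])
    refine ⟨_, _, hpa, hpb, ?_, ?_⟩
    · calc (b : ℝ≥0) * (T / N) ≤ N * (T / N) := by gcongr
        _ = T := hNT
    · have hab : a < b := by
        have := p.lt_succ i
        rw [hpa, hpb, ENNReal.coe_lt_coe] at this
        exact_mod_cast lt_of_mul_lt_mul_right this hd0.le
      -- The point (a + 1)T/N belongs to the partition, so the successor of aT/N cannot lie beyond
      -- it.
      obtain ⟨m, hm⟩ := hex (a + 1) (hab.trans_le hb)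
      have him : i.castSucc < m := by
        rw [← p.strictMono.lt_iff_lt, hpa, hm, ENNReal.coe_lt_coe]
        gcongr
        exact Nat.lt_succ_self a
      have hle : p.pt i.succ ≤ p.pt m := p.strictMono.monotone (Fin.castSucc_lt_iff_succ_le.1 him)
      rw [hpb, hm, ENNReal.coe_le_coe] at hle
      refine hle.trans ?_
      push_cast
      rw [add_mul, one_mul]
      gcongr

end TimePartition

/-! ### Convergence of Riemann sums along refinement -/

section Limits

variable {k : Type u} [NormedAddCommGroup k] [InnerProductSpace ℂ k] (S : QuantumStopTime k)

theorem isProj_stopIncr (p : TimePartition) (j : Fin (p.n + 1)) :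
    IsStarProjection (stopIncr S p j) := S.isProj_Ioc _ _

theorem stopIncr_mul_stopIncr (p : TimePartition) {i j : Fin (p.n + 1)} (h : i ≠ j) :
    stopIncr S p i * stopIncr S p j = 0 :=
  S.mul_eq_zero (p.interval_disjoint h) measurableSet_Ioc measurableSet_Ioc

/-- The half-open intervals partition (0, ∞] and miss only 0, which carries no mass. -/
theorem sum_stopIncr (h0 : S.toFun {0} = 0) (p : TimePartition) :
    ∑ j, stopIncr S p j = 1 := by
  rw [← S.apply_Ioc_zero_top h0]
  refine (S.apply_biUnion Finset.univ (A := p.interval)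
    (fun i _ j _ h => p.interval_disjoint h) (fun _ _ => measurableSet_Ioc)).symm.trans ?_
  congr 1
  ext t
  simp only [Finset.mem_univ, Set.iUnion_true, Set.mem_iUnion, Set.mem_Ioc, le_top, and_true]
  exact ⟨fun ⟨j, hj⟩ => zero_le.trans_lt hj.1, fun h => p.exists_mem_interval h⟩

/-- An increment over an interval of a partition is the sum of the increments over the intervals of
a refinement that it contains. -/
theorem stopIncr_eq_sum {p q : TimePartition} (i : Fin (q.n + 1) → Fin (p.n + 1))
    (hi : ∀ j, p.pt (i j).castSucc ≤ q.pt j.castSucc ∧ q.pt j.succ ≤ p.pt (i j).succ)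
    (a : Fin (p.n + 1)) :
    stopIncr S p a = ∑ j with i j = a, stopIncr S q j := by
  have hsub : ∀ j, q.interval j ⊆ p.interval (i j) := fun j =>
    Set.Ioc_subset_Ioc (hi j).1 (hi j).2
  refine Eq.trans ?_ (S.apply_biUnion (Finset.univ.filter fun j => i j = a) (A := q.interval)
    (fun i _ j _ h => q.interval_disjoint h) (fun _ _ => measurableSet_Ioc))
  rw [stopIncr]
  congr 1
  ext t
  simp only [Finset.mem_filter, Finset.mem_univ, true_and, Set.mem_iUnion, exists_prop]
  constructor
  · intro ht
    obtain ⟨j, hj⟩ := q.exists_mem_interval (zero_le.trans_lt ht.1)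
    refine ⟨j, ?_, hj⟩
    by_contra hne
    exact Set.disjoint_left.1 (p.interval_disjoint hne) (hsub j hj) ht
  · rintro ⟨j, rfl, hj⟩
    exact hsub j hj

theorem tendsto_stopIncr_last (h : S.toFun {∞} = 0) (x : F k) :
    Tendsto (fun p : TimePartition => stopIncr S p (Fin.last p.n) x) atTop (𝓝 0) := by
  rw [tendsto_zero_iff_norm_tendsto_zero, Metric.tendsto_nhds]
  intro ε hε
  obtain ⟨N, hN⟩ := ((Metric.tendsto_nhds.1 (S.tendsto_apply_Ioi h x) ε hε).and
    (eventually_ge_atTop 1)).exists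
  obtain ⟨p, hp, -⟩ := TimePartition.exists_mesh_le (T := N) (δ := 1)
    (by exact_mod_cast hN.2) one_pos
  filter_upwards [eventually_ge_atTop p] with q hq
  refine lt_of_le_of_lt ?_ hN.1
  rw [Real.dist_0_eq_abs, Real.dist_0_eq_abs, abs_norm, abs_norm]
  refine S.norm_apply_mono (fun t ht => ?_) measurableSet_Ioc measurableSet_Ioi x
  exact lt_of_le_of_lt ((by exact_mod_cast hp : (N : ℝ≥0∞) ≤ _).trans
    (TimePartition.last_mono hq)) ht.1

theorem exists_tendsto_of_cauchy {ι M : Type*} [NormedAddCommGroup M] [CompleteSpace M]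
    [Preorder ι] [Nonempty ι] [IsDirectedOrder ι] {u : ι → M}
    (h : ∀ ε > 0, ∃ p, ∀ q ≥ p, ‖u q - u p‖ ≤ ε) : ∃ y, Tendsto u atTop (𝓝 y) := by
  refine cauchy_map_iff_exists_tendsto.1 (Metric.cauchy_iff.2 ⟨inferInstance, fun ε hε => ?_⟩)
  obtain ⟨p, hp⟩ := h (ε / 3) (by positivity)
  refine ⟨u '' Set.Ici p, image_mem_map (Ici_mem_atTop p), ?_⟩
  rintro _ ⟨a, ha, rfl⟩ _ ⟨b, hb, rfl⟩
  have h1 := hp a ha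
  have h2 := hp b hb
  rw [← dist_eq_norm] at h1 h2
  linarith [dist_triangle_right (u a) (u b) (u p)]

/-- A convergence criterion for the Riemann sums `∑_j S((π_{j-1}, π_j]) v(π_j)` of a vector-valued
function `v` with respect to a quantum stop time. -/
theorem exists_tendsto_riemannSum (h0 : S.toFun {0} = 0) (hT : S.toFun {∞} = 0)
    (v : ℝ≥0∞ → F k) (w : F k) (C : ℝ)
    (h1 : ∀ T : ℝ≥0, ∀ η > 0, ∃ δ : ℝ≥0, 0 < δ ∧ ∀ s t b : ℝ≥0, s ≤ t → t ≤ b → b ≤ T →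
      b ≤ t + δ → ‖S.toFun (Set.Ioc s t) (v t - v b)‖ ≤ η * ‖S.toFun (Set.Ioc s t) w‖)
    (h2 : ∀ s t : ℝ≥0∞, s ≤ t →
      ‖S.toFun (Set.Ioc s t) (v t - v ∞)‖ ≤ C * ‖S.toFun (Set.Ioc s t) w‖) :
    ∃ y, Tendsto (fun p : TimePartition => ∑ j, stopIncr S p j (v (p.pt j.succ)))
      atTop (𝓝 y) := by
  refine exists_tendsto_of_cauchy fun ε hε => ?_
  -- N makes the tail beyond it contribute at most ε/2. The bounded part gets η = ε/2/(‖w‖ + 1),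
  -- where the 1 allows w = 0.
  obtain ⟨N, hN, hN1⟩ := (((S.tendsto_apply_Ioi hT w).const_mul |C|).eventually
    (gt_mem_nhds (by rw [mul_zero]; exact half_pos hε)) |>.and (eventually_ge_atTop 1)).exists
  set η := ε / 2 / (‖w‖ + 1) with hη
  have hη0 : 0 < η := by positivity
  obtain ⟨δ, hδ, hδ1⟩ := h1 N η hη0
  obtain ⟨p, hp1, hp2⟩ := TimePartition.exists_mesh_le (T := N) (δ := δ)
    (by exact_mod_cast hN1) hδ
  refine ⟨p, fun q hq => ?_⟩
  choose i hi using TimePartition.exists_interval_subset hq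
  -- The coarse sum is rewritten over the finer partition, so that both sums use the same orthogonal
  -- projections.
  have e1 : ∑ a, stopIncr S p a (v (p.pt a.succ)) =
      ∑ j, stopIncr S q j (v (p.pt (i j).succ)) := by
    rw [← Finset.sum_fiberwise Finset.univ i fun j => stopIncr S q j (v (p.pt (i j).succ))]
    refine Finset.sum_congr rfl fun a _ => ?_
    rw [stopIncr_eq_sum S i hi a, _root_.sum_apply]
    refine Finset.sum_congr rfl fun j hj => ?_
    rw [(Finset.mem_filter.1 hj).2]
  rw [e1, ← Finset.sum_sub_distrib]
  simp only [← map_sub]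
  have hterm : ∀ j, ‖stopIncr S q j (v (q.pt j.succ) - v (p.pt (i j).succ))‖ ^ 2 ≤
      η ^ 2 * ‖stopIncr S q j w‖ ^ 2 +
        if i j = Fin.last p.n then C ^ 2 * ‖stopIncr S q j w‖ ^ 2 else 0 := by
    intro j
    split_ifs with hl
    · rw [hl, Fin.succ_last, p.pt_last]
      have := h2 _ _ (q.lt_succ j).le
      have h3 : ‖stopIncr S q j (v (q.pt j.succ) - v ∞)‖ ^ 2 ≤
          (C * ‖stopIncr S q j w‖) ^ 2 := pow_le_pow_left₀ (norm_nonneg _) this 2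
      nlinarith [mul_nonneg (sq_nonneg η) (sq_nonneg ‖stopIncr S q j w‖)]
    · obtain ⟨a, b, ha, hb, hbT, hab⟩ := hp2 (i j) hl
      have hij := hi j
      rw [ha, hb] at hij
      have hlt := q.lt_succ j
      rw [add_zero, ← mul_pow, hb]
      refine pow_le_pow_left₀ (norm_nonneg _) ?_ 2
      rw [stopIncr]
      have ht : q.pt j.succ ≠ ∞ := ne_top_of_le_ne_top ENNReal.coe_ne_top hij.2
      have hs : q.pt j.castSucc ≠ ∞ := (hlt.trans_le le_top).ne
      generalize q.pt j.succ = t at *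
      generalize q.pt j.castSucc = s at *
      lift t to ℝ≥0 using ht
      lift s to ℝ≥0 using hs
      norm_cast at hij hlt
      exact hδ1 s t b hlt.le hij.2 hbT
        (hab.trans (add_le_add_left (hij.1.trans hlt.le) δ))
  have hsq : ‖∑ j, stopIncr S q j (v (q.pt j.succ) - v (p.pt (i j).succ))‖ ^ 2 ≤ ε ^ 2 := by
    rw [norm_sum_sq_of_orthogonal Finset.univ (isProj_stopIncr S q)
      (fun a b h => stopIncr_mul_stopIncr S q h)]
    refine (Finset.sum_le_sum fun j _ => hterm j).trans ?_
    -- Pythagoras in reverse: the weights ‖P_j w‖² add up to ‖w‖² over all intervals, and to the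
    -- squared norm of the coarse last increment at w over the unbounded one.
    rw [Finset.sum_add_distrib, ← Finset.mul_sum, ← Finset.sum_filter, ← Finset.mul_sum,
      ← norm_sum_sq_of_orthogonal Finset.univ (isProj_stopIncr S q)
        (fun a b h => stopIncr_mul_stopIncr S q h) (fun _ => w),
      ← norm_sum_sq_of_orthogonal (Finset.univ.filter fun j => i j = Fin.last p.n)
        (isProj_stopIncr S q) (fun a b h => stopIncr_mul_stopIncr S q h) (fun _ => w),
      ← _root_.sum_apply, ← _root_.sum_apply, sum_stopIncr S h0, one_apply_eq_self,
      ← stopIncr_eq_sum S i hi]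
    have b1 : η * ‖w‖ ≤ ε / 2 := by
      rw [hη, div_mul_eq_mul_div, div_le_iff₀ (by positivity)]
      nlinarith [norm_nonneg w]
    have b2 : |C| * ‖stopIncr S p (Fin.last p.n) w‖ ≤ ε / 2 := by
      refine le_trans ?_ hN.le
      gcongr
      refine S.norm_apply_mono (fun t ht => ?_) measurableSet_Ioc measurableSet_Ioi w
      exact lt_of_le_of_lt (by exact_mod_cast hp1) ht.1
    have c1 := pow_le_pow_left₀ (by positivity) b1 2
    have c2 := pow_le_pow_left₀ (by positivity) b2 2
    rw [mul_pow] at c1 c2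
    rw [sq_abs] at c2
    nlinarith [sq_nonneg ε]
  exact (sq_le_sq₀ (norm_nonneg _) hε.le).1 hsq

end Limits

/-! ### The stopped flow and the stopped shift -/

section Riemann

variable {k : Type u} [NormedAddCommGroup k] [InnerProductSpace ℂ k] (S : QuantumStopTime k)

theorem commute_stopIncr_ccr (p : TimePartition) (j : Fin (p.n + 1)) (X : F k →L[ℂ] F k) :
    Commute (stopIncr S p j) (ccr (p.pt j.succ) X) :=
  S.commute_Ioc_ccr (p.lt_succ j).le le_rfl X

/-- The homomorphism `X ↦ ∑_j h_j(X) P_j`, for homomorphisms `h_j` and mutually orthogonal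
projections `P_j` that commute with the range of `h_j`. -/
noncomputable def sumHom {A : Type*} [Semiring A] [StarRing A] [Algebra ℂ A] {ι : Type*}
    [Fintype ι] (h : ι → A →⋆ₐ[ℂ] A) (P : ι → A) (hP : ∀ i, IsStarProjection (P i))
    (hPQ : ∀ i j, i ≠ j → P i * P j = 0) (hc : ∀ i X, Commute (P i) (h i X)) : A →⋆ₙₐ[ℂ] A where
  toFun X := ∑ i, h i X * P i
  map_smul' c X := by simp [Finset.smul_sum]
  map_zero' := by simp
  map_add' X Y := by simp [add_mul, Finset.sum_add_distrib]
  map_mul' X Y := by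
    rw [Finset.sum_mul_sum]
    refine Finset.sum_congr rfl fun i _ => ?_
    rw [Finset.sum_eq_single i]
    · rw [map_mul, mul_assoc, mul_assoc, ← mul_assoc (P i), (hc i Y).eq, mul_assoc (h i Y),
        (hP i).isIdempotentElem.eq]
    · intro j _ hj
      rw [← (hc j Y).eq, mul_assoc, ← mul_assoc (P i), hPQ i j hj.symm, zero_mul, mul_zero]
    · simp
  map_star' X := by
    rw [star_sum]
    refine Finset.sum_congr rfl fun i _ => ?_
    rw [star_mul, (hP i).isSelfAdjoint.star_eq, ← map_star, (hc i _).eq]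

/-- `X ↦ σ_{S,π}(X) - S((π_n, ∞])`. -/
noncomputable def flowPart (p : TimePartition) :
    (F k →L[ℂ] F k) →⋆ₙₐ[ℂ] (F k →L[ℂ] F k) :=
  sumHom (fun j : Fin p.n => ccrFlowHom (p.pt j.castSucc.succ).toNNReal)
    (fun j => stopIncr S p j.castSucc) (fun j => isProj_stopIncr S p _)
    (fun i j h => stopIncr_mul_stopIncr S p ((Fin.castSucc_injective _).ne h))
    (fun j X => by
      have := commute_stopIncr_ccr S p j.castSucc X
      rwa [ccr, if_neg (p.pt_succ_ne_top (Fin.castSucc_lt_last j).ne), ← ccrFlowHom_apply] at this)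

theorem flowPart_apply (p : TimePartition) (X : F k →L[ℂ] F k) :
    flowPart S p X =
      ∑ j : Fin p.n, ccr (p.pt j.castSucc.succ) X * stopIncr S p j.castSucc := by
  change ∑ j : Fin p.n, ccrFlowHom (p.pt j.castSucc.succ).toNNReal X *
    stopIncr S p j.castSucc = _
  refine Finset.sum_congr rfl fun j _ => ?_
  rw [ccr, if_neg (p.pt_succ_ne_top (Fin.castSucc_lt_last j).ne), ← ccrFlowHom_apply]

theorem flowSum_eq (p : TimePartition) (X : F k →L[ℂ] F k) :
    flowSum S p X = flowPart S p X + stopIncr S p (Fin.last p.n) := by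
  rw [flowSum, Fin.sum_univ_castSucc, flowPart_apply, Fin.succ_last, p.pt_last, ccr_top, one_mul]

theorem flowPart_mul_last (p : TimePartition) (X : F k →L[ℂ] F k) :
    flowPart S p X * stopIncr S p (Fin.last p.n) = 0 := by
  rw [flowPart_apply, Finset.sum_mul]
  refine Finset.sum_eq_zero fun j _ => ?_
  rw [mul_assoc, stopIncr_mul_stopIncr S p (Fin.castSucc_lt_last j).ne, mul_zero]

theorem last_mul_flowPart (p : TimePartition) (X : F k →L[ℂ] F k) :
    stopIncr S p (Fin.last p.n) * flowPart S p X = 0 := by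
  rw [flowPart_apply, Finset.mul_sum]
  refine Finset.sum_eq_zero fun j _ => ?_
  rw [← (commute_stopIncr_ccr S p _ X).eq, ← mul_assoc,
    stopIncr_mul_stopIncr S p (Fin.castSucc_lt_last j).ne', zero_mul]

/-- The homomorphic part and the last increment annihilate each other, and the latter is idempotent.
-/
theorem flowSum_mul (p : TimePartition) (X Y : F k →L[ℂ] F k) :
    flowSum S p (X * Y) = flowSum S p X * flowSum S p Y := by
  rw [flowSum_eq, flowSum_eq, flowSum_eq, add_mul, mul_add, mul_add, flowPart_mul_last,
    last_mul_flowPart, add_zero, zero_add, map_mul,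
    (isProj_stopIncr S p _).isIdempotentElem.eq]

theorem flowSum_star (p : TimePartition) (X : F k →L[ℂ] F k) :
    flowSum S p (star X) = star (flowSum S p X) := by
  rw [flowSum_eq, flowSum_eq, star_add, map_star, (isProj_stopIncr S p _).isSelfAdjoint.star_eq]

theorem ccr_one (t : ℝ≥0∞) : ccr t (1 : F k →L[ℂ] F k) = 1 := by
  rw [ccr]
  split_ifs
  · rfl
  · rw [← ccrFlowHom_apply, map_one]

theorem flowSum_one (h0 : S.toFun {0} = 0) (p : TimePartition) : flowSum S p 1 = 1 := by
  simp only [flowSum, ccr_one, one_mul]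
  exact sum_stopIncr S h0 p

theorem norm_stopIncr_le (p : TimePartition) (j : Fin (p.n + 1)) : ‖stopIncr S p j‖ ≤ 1 :=
  ContinuousLinearMap.opNorm_le_bound _ zero_le_one fun x => by
    rw [one_mul]
    exact norm_apply_le_of_isStarProjection (isProj_stopIncr S p j) x

theorem norm_flowSum_le (p : TimePartition) (X : F k →L[ℂ] F k) :
    ‖flowSum S p X‖ ≤ ‖X‖ + 1 := by
  rw [flowSum_eq]
  exact (norm_add_le _ _).trans
    (add_le_add (NonUnitalStarAlgHom.norm_apply_le _ _) (norm_stopIncr_le S p _))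

theorem norm_ccr_le (t : ℝ≥0∞) (X : F k →L[ℂ] F k) : ‖ccr t X‖ ≤ ‖X‖ + 1 := by
  rw [ccr]
  split_ifs
  · exact (ContinuousLinearMap.norm_id_le).trans (by linarith [norm_nonneg X])
  · exact (norm_ccrFlow_le _ X).trans (by linarith)

/-- Commutation moves the projections to the left, the form required by `exists_tendsto_riemannSum`.
-/
theorem flowSum_apply (p : TimePartition) (X : F k →L[ℂ] F k) (x : F k) :
    flowSum S p X x = ∑ j, stopIncr S p j (ccr (p.pt j.succ) X x) := by
  rw [flowSum, _root_.sum_apply]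
  refine Finset.sum_congr rfl fun j _ => ?_
  rw [← (commute_stopIncr_ccr S p j X).eq, mul_apply_eq_comp]

theorem exists_tendsto_flowSum_ev (h0 : S.toFun {0} = 0) (hT : S.toFun {∞} = 0)
    (X : F k →L[ℂ] F k) (f : L2 k) :
    ∃ y, Tendsto (fun p => flowSum S p X (ev f)) atTop (𝓝 y) := by
  simp only [flowSum_apply]
  refine exists_tendsto_riemannSum S h0 hT (fun t => ccr t X (ev f)) (ev f) (‖X‖ + 1 + 1)
    (fun T η hη => ?_) (fun s t hst => ?_)
  · obtain ⟨δ, hδ, h⟩ := exists_norm_sub_ccrFlow_le X f T hη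
    refine ⟨δ, hδ, fun s t b hst htb hbT hb => ?_⟩
    obtain ⟨r, rfl⟩ := exists_add_of_le htb
    have e : ccr t X (ev f) - ccr ((t + r : ℝ≥0) : ℝ≥0∞) X (ev f) =
        ccrFlow t (X - ccrFlow r X) (ev f) := by
      rw [ccr_coe, ccr_coe, ccrFlow_add, ccrFlow_sub, _root_.sub_apply]
    rw [e]
    refine (S.norm_Ioc_ccrFlow_ev_le hst _ f).trans ?_
    gcongr
    exact h r (le_of_add_le_add_left hb) t (htb.trans hbT)
  -- On the unbounded interval boundedness is enough: the increment commutes with σ_t(X) - I, whose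
  -- norm is at most ‖X‖ + 2.
  · have e : S.toFun (Set.Ioc s t) (ccr t X (ev f) - ccr ∞ X (ev f)) =
        (ccr t X - 1) (S.toFun (Set.Ioc s t) (ev f)) := by
      rw [ccr_top, ← _root_.sub_apply, ← mul_apply_eq_comp, ← mul_apply_eq_comp,
        ((S.commute_Ioc_ccr hst le_rfl X).sub_right (Commute.one_right _)).eq]
    rw [e]
    exact ContinuousLinearMap.le_of_opNorm_le _ ((norm_sub_le _ _).trans
      (add_le_add (norm_ccr_le t X) ContinuousLinearMap.norm_id_le)) _

/-- A uniformly bounded family of operators on Fock space that converges on exponential vectors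
converges strongly. -/
theorem exists_tendsto_of_ev {ι M H : Type*} [NormedAddCommGroup M] [NormedSpace ℂ M]
    [CompleteSpace M] [NormedAddCommGroup H] [InnerProductSpace ℂ H] {l : Filter ι} [l.NeBot]
    {T : ι → Fock H →L[ℂ] M} {C : ℝ} (hC : ∀ i, ‖T i‖ ≤ C)
    (h : ∀ f, ∃ y, Tendsto (fun i => T i (ev f)) l (𝓝 y)) :
    ∃ A : Fock H →L[ℂ] M, ∀ x, Tendsto (fun i => T i x) l (𝓝 (A x)) := by
  have key : ∀ x, ∃ y, Tendsto (fun i => T i x) l (𝓝 y) := by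
    intro x
    refine cauchy_map_iff_exists_tendsto.1 (cauchy_map_iff'.2 ?_)
    rw [uniformity_eq_comap_nhds_zero, tendsto_comap_iff]
    have := tendsto_of_tendsto_ev (l := l ×ˢ l) (T := fun z : ι × ι => T z.2 - T z.1) (A := 0)
      (C := C + C) (fun z => (norm_sub_le _ _).trans (add_le_add (hC _) (hC _))) (fun f => ?_) x
    · exact this
    · obtain ⟨y, hy⟩ := h f
      simpa using (hy.comp tendsto_snd).sub (hy.comp tendsto_fst)
  choose A hA using key
  refine ⟨LinearMap.mkContinuous ⟨⟨A, fun x y => ?_⟩, fun c x => ?_⟩ C fun x => ?_, hA⟩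
  · exact tendsto_nhds_unique (hA (x + y)) (by simpa using (hA x).add (hA y))
  · exact tendsto_nhds_unique (hA (c • x)) (by simpa using (hA x).const_smul c)
  · exact le_of_tendsto (hA x).norm
      (Eventually.of_forall fun i => ContinuousLinearMap.le_of_opNorm_le _ (hC i) x)

/-- The strong limit of the Riemann sums `σ_{S,π}` is a unital `*`-homomorphism. -/
theorem exists_stoppedFlow (h0 : S.toFun {0} = 0) (hT : S.toFun {∞} = 0) :
    ∃ σ : (F k →L[ℂ] F k) →⋆ₐ[ℂ] (F k →L[ℂ] F k),
      ∀ X x, Tendsto (fun p => flowSum S p X x) atTop (𝓝 (σ X x)) := by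
  have key := fun X : F k →L[ℂ] F k =>
    exists_tendsto_of_ev (fun p => norm_flowSum_le S p X) (exists_tendsto_flowSum_ev S h0 hT X)
  choose σ hσ using key
  -- Dropping the vanishing last increment leaves approximants that are linear in X; linearity of
  -- the limit is read off from these.
  have hpart : ∀ X x, Tendsto (fun p => flowPart S p X x) atTop (𝓝 (σ X x)) := by
    intro X x
    have := (hσ X x).sub (tendsto_stopIncr_last S hT x)
    rw [sub_zero] at this
    refine this.congr fun p => ?_
    rw [flowSum_eq, _root_.add_apply, add_sub_cancel_right]
  have hsmul : ∀ (c : ℂ) X, σ (c • X) = c • σ X := fun c X => by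
    ext x
    refine tendsto_nhds_unique (hpart (c • X) x) ?_
    simpa using (hpart X x).const_smul c
  have hone : σ 1 = 1 := by
    ext x
    refine tendsto_nhds_unique (hσ 1 x) ?_
    simp only [flowSum_one S h0, one_apply_eq_self]
    exact tendsto_const_nhds
  refine ⟨{ toFun := σ, map_one' := hone, map_mul' := fun X Y => ?_, map_zero' := ?_,
            map_add' := fun X Y => ?_, commutes' := fun c => ?_, map_star' := fun X => ?_ }, hσ⟩
  · ext x
    refine tendsto_nhds_unique (hσ (X * Y) x) ?_
    -- Strong limits of products need a uniform bound on the left factor.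
    have h1 : Tendsto (fun p => flowSum S p X (flowSum S p Y x - σ Y x)) atTop (𝓝 0) := by
      refine squeeze_zero_norm (fun p => ContinuousLinearMap.le_of_opNorm_le _
        (norm_flowSum_le S p X) _) ?_
      simpa using (tendsto_iff_norm_sub_tendsto_zero.1 (hσ Y x)).const_mul (‖X‖ + 1)
    have h2 := h1.add (hσ X (σ Y x))
    rw [zero_add] at h2
    refine h2.congr fun p => ?_
    rw [← map_add, sub_add_cancel, flowSum_mul, mul_apply_eq_comp]
  · simpa using hsmul 0 0
  · ext x
    refine tendsto_nhds_unique (hpart (X + Y) x) ?_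
    simpa using (hpart X x).add (hpart Y x)
  · change σ (algebraMap ℂ _ c) = _
    rw [Algebra.algebraMap_eq_smul_one, hsmul, hone]
  · ext x
    refine ext_inner_left ℂ fun y => ?_
    have h1 := (tendsto_const_nhds (x := y)).inner (𝕜 := ℂ) (hσ (star X) x)
    have h2 := (hσ X y).inner (𝕜 := ℂ) (tendsto_const_nhds (x := x))
    rw [ContinuousLinearMap.star_eq_adjoint (σ X), ContinuousLinearMap.adjoint_inner_right]
    refine tendsto_nhds_unique h1 (h2.congr fun p => ?_)
    rw [flowSum_star, ContinuousLinearMap.star_eq_adjoint (flowSum S p X),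
      ContinuousLinearMap.adjoint_inner_right]

theorem shiftSum_apply (p : TimePartition) (x : F k) :
    shiftSum S p x = ∑ j, stopIncr S p j (Gam k (p.pt j.succ) x) := by
  rw [shiftSum, _root_.sum_apply]
  rfl

theorem exists_tendsto_shiftSum (h0 : S.toFun {0} = 0) (hT : S.toFun {∞} = 0) (x : F k) :
    ∃ y, Tendsto (fun p => shiftSum S p x) atTop (𝓝 y) := by
  simp only [shiftSum_apply]
  refine exists_tendsto_riemannSum S h0 hT (fun t => Gam k t x) (ev 0) (2 * ‖x‖)
    (fun T η hη => ?_) (fun s t hst => ?_)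
  · obtain ⟨δ, hδ, h⟩ := Metric.tendsto_nhds_nhds.1 (tendsto_Gam_zero x) η hη
    refine ⟨(δ / 2).toNNReal, Real.toNNReal_pos.2 (by positivity), fun s t b hst htb hbT hb => ?_⟩
    obtain ⟨r, rfl⟩ := exists_add_of_le htb
    have e : Gam k t x - Gam k ((t + r : ℝ≥0) : ℝ≥0∞) x = Gam k t (x - Gam k r x) := by
      rw [Gam_add, mul_apply_eq_comp, map_sub]
    rw [e, S.norm_Ioc_Gam hst, mul_comm]
    gcongr
    have hr : (r : ℝ) ≤ δ / 2 :=
      (Real.le_toNNReal_iff_coe_le (by positivity)).1 (le_of_add_le_add_left hb)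
    rw [norm_sub_rev, ← dist_eq_norm]
    refine (h ?_).le
    rw [NNReal.dist_eq, NNReal.coe_zero, sub_zero, abs_of_nonneg r.coe_nonneg]
    linarith
  · rcases eq_or_ne t ∞ with rfl | ht
    · rw [sub_self, map_zero, norm_zero]
      positivity
    · lift t to ℝ≥0 using ht
      lift s to ℝ≥0 using ne_top_of_le_ne_top ENNReal.coe_ne_top hst
      have e : Gam k t x - Gam k ∞ x = Gam k t (x - vacProj k x) := by
        rw [Gam_top, map_sub, ← mul_apply_eq_comp (Gam k t), Gam_mul_vacProj]
      rw [e, S.norm_Ioc_Gam (by exact_mod_cast hst), mul_comm]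
      gcongr
      linarith [norm_sub_le x (vacProj k x), norm_vacProj_apply_le x]

/-- Pythagoras, with ‖P_jε(0)‖²‖x‖² for each bounded interval. These weights sum to 1 less that of
the last interval, where Γ_∞ = E_0 enters instead; both corrections vanish in the limit. -/
theorem norm_shiftSum_sq (h0 : S.toFun {0} = 0) (p : TimePartition) (x : F k) :
    ‖shiftSum S p x‖ ^ 2 = ‖x‖ ^ 2 - ‖stopIncr S p (Fin.last p.n) (ev 0)‖ ^ 2 * ‖x‖ ^ 2 +
      ‖stopIncr S p (Fin.last p.n) (vacProj k x)‖ ^ 2 := by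
  have h1 : ∑ j : Fin p.n, ‖stopIncr S p j.castSucc (ev 0)‖ ^ 2 +
      ‖stopIncr S p (Fin.last p.n) (ev 0)‖ ^ 2 = 1 := by
    rw [← Fin.sum_univ_castSucc (fun j => ‖stopIncr S p j (ev 0)‖ ^ 2),
      ← norm_sum_sq_of_orthogonal Finset.univ (isProj_stopIncr S p)
        (fun a b h => stopIncr_mul_stopIncr S p h) (fun _ => ev 0), ← _root_.sum_apply,
      sum_stopIncr S h0, one_apply_eq_self, norm_ev_zero, one_pow]
  rw [shiftSum_apply, norm_sum_sq_of_orthogonal Finset.univ (isProj_stopIncr S p)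
    (fun a b h => stopIncr_mul_stopIncr S p h), Fin.sum_univ_castSucc, Fin.succ_last, p.pt_last,
    Gam_top]
  have h2 : ∀ j : Fin p.n, ‖stopIncr S p j.castSucc (Gam k (p.pt j.castSucc.succ) x)‖ ^ 2 =
      ‖stopIncr S p j.castSucc (ev 0)‖ ^ 2 * ‖x‖ ^ 2 := by
    intro j
    have ht := p.pt_succ_ne_top (Fin.castSucc_lt_last j).ne
    have hlt := p.lt_succ j.castSucc
    rw [stopIncr]
    generalize p.pt j.castSucc.succ = t at *
    generalize p.pt j.castSucc.castSucc = s at *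
    lift t to ℝ≥0 using ht
    lift s to ℝ≥0 using (hlt.trans_le le_top).ne
    rw [S.norm_Ioc_Gam (by exact_mod_cast hlt.le), mul_pow]
  rw [Finset.sum_congr rfl fun j _ => h2 j, ← Finset.sum_mul]
  linear_combination ‖x‖ ^ 2 * h1

/-- The strong limit of the Riemann sums `Γ_{S,π}` is an isometry. -/
theorem exists_stoppedShift (h0 : S.toFun {0} = 0) (hT : S.toFun {∞} = 0) :
    ∃ Γ : F k →ₗᵢ[ℂ] F k, ∀ x, Tendsto (fun p => shiftSum S p x) atTop (𝓝 (Γ x)) := by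
  choose Γ hΓ using exists_tendsto_shiftSum S h0 hT
  refine ⟨⟨⟨⟨Γ, fun x y => ?_⟩, fun c x => ?_⟩, fun x => ?_⟩, hΓ⟩
  · exact tendsto_nhds_unique (hΓ (x + y)) (by simpa using (hΓ x).add (hΓ y))
  · exact tendsto_nhds_unique (hΓ (c • x)) (by simpa using (hΓ x).const_smul c)
  · have h1 : Tendsto (fun p => ‖shiftSum S p x‖ ^ 2) atTop (𝓝 (‖x‖ ^ 2)) := by
      simp only [norm_shiftSum_sq S h0]
      have a := ((tendsto_stopIncr_last S hT (ev 0)).norm.pow 2).mul_const (‖x‖ ^ 2)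
      have b := (tendsto_stopIncr_last S hT (vacProj k x)).norm.pow 2
      simpa using (a.const_sub (‖x‖ ^ 2)).add b
    have h2 : ‖Γ x‖ ^ 2 = ‖x‖ ^ 2 := tendsto_nhds_unique ((hΓ x).norm.pow 2) h1
    exact (sq_eq_sq₀ (norm_nonneg _) (norm_nonneg _)).1 h2

/-- Orthogonality leaves only diagonal terms, and σ_tΓ_t intertwines exactly for finite t. The
defect sits in the last interval, where E_0 appears in place of E_0 X. -/
theorem flowSum_mul_shiftSum (p : TimePartition) (X : F k →L[ℂ] F k) :
    flowSum S p X * shiftSum S p = shiftSum S p * X +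
      stopIncr S p (Fin.last p.n) * (vacProj k - vacProj k * X) := by
  have h1 : flowSum S p X * shiftSum S p =
      ∑ j, stopIncr S p j * (ccr (p.pt j.succ) X * Gam k (p.pt j.succ)) := by
    rw [flowSum, shiftSum, Finset.sum_mul_sum]
    refine Finset.sum_congr rfl fun i _ => ?_
    rw [Finset.sum_eq_single i]
    · rw [mul_assoc, ← mul_assoc (stopIncr S p i), (isProj_stopIncr S p i).isIdempotentElem.eq,
        ← mul_assoc, ← (commute_stopIncr_ccr S p i X).eq, mul_assoc]
    · intro j _ hj
      rw [mul_assoc, ← mul_assoc (stopIncr S p i), stopIncr_mul_stopIncr S p hj.symm, zero_mul,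
        mul_zero]
    · simp
  have h2 : ∀ j : Fin p.n, ccr (p.pt j.castSucc.succ) X * Gam k (p.pt j.castSucc.succ) =
      Gam k (p.pt j.castSucc.succ) * X := by
    intro j
    have ht := p.pt_succ_ne_top (Fin.castSucc_lt_last j).ne
    generalize p.pt j.castSucc.succ = t at *
    lift t to ℝ≥0 using ht
    rw [ccr_coe, ccrFlow_mul_Gam]
  rw [h1, shiftSum, Fin.sum_univ_castSucc, Fin.sum_univ_castSucc, Fin.succ_last, p.pt_last,
    ccr_top, Gam_top, one_mul, add_mul, Finset.sum_mul, mul_sub]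
  simp only [h2, mul_assoc]
  abel

end Riemann

end QStop

theorem mainTheorem2 {k : Type*} [NormedAddCommGroup k] [InnerProductSpace ℂ k] [CompleteSpace k]
    (S : QStop.QuantumStopTime k) (hS : S.IsFinite) :
    (∀ p : QStop.TimePartition,
      QStop.flowSum S p 1 = 1 ∧
      (∀ X Y, QStop.flowSum S p (X * Y) = QStop.flowSum S p X * QStop.flowSum S p Y) ∧
      (∀ X, QStop.flowSum S p (star X) = star (QStop.flowSum S p X)) ∧
      ∃ φ : (QStop.F k →L[ℂ] QStop.F k) →⋆ₙₐ[ℂ] (QStop.F k →L[ℂ] QStop.F k),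
        ∀ X, QStop.flowSum S p X = φ X + QStop.stopIncr S p (Fin.last p.n)) ∧
    ∃ σ : (QStop.F k →L[ℂ] QStop.F k) →⋆ₐ[ℂ] (QStop.F k →L[ℂ] QStop.F k),
      (∀ X x, Tendsto (fun p => QStop.flowSum S p X x) atTop (𝓝 (σ X x))) ∧
      ∃ Γ : QStop.F k →ₗᵢ[ℂ] QStop.F k,
        (∀ x, Tendsto (fun p => QStop.shiftSum S p x) atTop (𝓝 (Γ x))) ∧
        ∀ X, σ X * Γ.toContinuousLinearMap = Γ.toContinuousLinearMap * X := by
  refine ⟨fun p => ⟨QStop.flowSum_one S hS.zero p, QStop.flowSum_mul S p, QStop.flowSum_star S p,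
    QStop.flowPart S p, QStop.flowSum_eq S p⟩, ?_⟩
  obtain ⟨σ, hσ⟩ := QStop.exists_stoppedFlow S hS.zero hS.top
  obtain ⟨Γ, hΓ⟩ := QStop.exists_stoppedShift S hS.zero hS.top
  refine ⟨σ, hσ, Γ, hΓ, fun X => ?_⟩
  ext x
  -- The bound ‖X‖ + 1 on the Riemann sums allows the limit to be taken in both factors at once.
  have h1 : Tendsto (fun p => QStop.flowSum S p X (QStop.shiftSum S p x - Γ x)) atTop (𝓝 0) := by
    refine squeeze_zero_norm (fun p => ContinuousLinearMap.le_of_opNorm_le _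
      (QStop.norm_flowSum_le S p X) _) ?_
    simpa using (tendsto_iff_norm_sub_tendsto_zero.1 (hΓ x)).const_mul (‖X‖ + 1)
  have h2 := h1.add (hσ X (Γ x))
  have h3 := (hΓ (X x)).add (QStop.tendsto_stopIncr_last S hS.top
    (QStop.vacProj k x - QStop.vacProj k (X x)))
  rw [zero_add] at h2
  rw [add_zero] at h3
  refine tendsto_nhds_unique h2 (h3.congr fun p => ?_)
  rw [← map_add, sub_add_cancel, ← mul_apply_eq_comp (QStop.flowSum S p X), QStop.flowSum_mul_shiftSum]
  rfl
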